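/- Let $k$ be a field, let $T$ be a rooted tree on the vertex set $[n]=\{1,\dots,n\}$ (edges directed away from the root; an isolated vertex is allowed), let $m$ be the number of its leaves (vertices without children), and let $R=k[x_1,\dots,x_n]$ with its standard grading and $\mathfrak m=(x_1,\dots,x_n)$. The max-path ideal $PI(T)\subseteq R$ is generated by the monomials $x_{i_1}\cdots x_{i_t}$ such that $i_1,\dots,i_t$ is a directed path from the root to a leaf. A monomial ideal $I$ is of decreasing type with respect to an ordering $u_1,\dots,u_r$ of its minimal monomial generators if for each $j$ there is $x_i\in\operatorname{supp}(u_j)$ with $\deg_{x_i}(u_j)>\deg_{x_i}(u_s)$ for all $s<j$. Its iterated mapping cones (with respect to this ordering) are built as follows: start with the minimal graded free resolution of $R/(0)$; for $j=1,\dots,r$, with $I_{j-1}=(u_1,\dots,u_{j-1})$, replace the complex $F$ obtained for $I_{j-1}$ by the mapping cone of a graded chain map $G(-\deg u_j)\to F$ lifting the multiplication $u_j\colon R/(I_{j-1}:u_j)(-\deg u_j)\to R/I_{j-1}$, where $G$ is a minimal graded free resolution of $R/(I_{j-1}:u_j)$. For a graded module $M$ let $\beta_{i,j}(M)$ be the number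 of degree $j$ basis elements in homological degree $i$ of its minimal graded free resolution, and put $\beta_i(M)=\sum_j\beta_{i,j}(M)$, $\operatorname{pd}(M)=\max\{i:\beta_{i,j}(M)\ne0\text{ for some }j\}$ and $\operatorname{reg}(M)=\max\{j-i:\beta_{i,j}(M)\neq 0\}$. Let $\operatorname{depth}(M)$ be the maximal length of an $M$-regular sequence in $\mathfrak m$, and call $M$ Cohen–Macaulay if $\operatorname{depth}(M)=\dim(M)$. Then: (i) The minimal monomial generators of $PI(T)$ can be ordered, and $PI(T)$ is of decreasing type with respect to every ordering of them. For every ordering, iterated mapping cones exist, and each of them is a minimal graded free resolution of $R/PI(T)$. (ii) $\dim(R/PI(T))=n-1$. (iii) (a) $\beta_i(R/PI(T))=\binom{m}{i}$ for all $i\ge0$; (b) $\operatorname{pd}(R/PI(T))=m$ and $\operatorname{depth}(R/PI(T))=n-m$; (c) $\operatorname{reg}(R/PI(T))=n-m$. (iv) $R/PI(T)$ is Cohen–Macaulay if and only if $T$ is a directed path (that is, its vertices can be listed as $i_1,\dots,i_n$ so that its directed edges are exactly $(i_j,i_{j+1})$, $1\le j<n$). -/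

import Mathlib

open scoped BigOperators

noncomputable section

namespace MaxPath

/-! ## Graded free complexes and resolutions over a polynomial ring -/

section Algebra

variable {σ k : Type*} [Field k]

/-- The homogeneous component of integer degree `j` of `k[x_s : s ∈ σ]`
(zero in negative degrees). -/
def homogPart (σ k : Type*) [Field k] : ℤ → Submodule k (MvPolynomial σ k)
  | Int.ofNat d => MvPolynomial.homogeneousSubmodule σ k d
  | Int.negSucc _ => ⊥

/-- The grading of `R ⧸ I` induced by the standard grading of `R = k[x_s : s ∈ σ]`. -/
def quotientGrading (I : Ideal (MvPolynomial σ k)) (j : ℤ) :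
    Submodule k (MvPolynomial σ k ⧸ I) :=
  (homogPart σ k j).map (Ideal.Quotient.mkₐ k I).toLinearMap

/-- A complex `⋯ → F₂ → F₁ → F₀` of finitely generated graded free modules over
`R = k[x_s : s ∈ σ]`, given by matrices. `ι i` indexes a homogeneous basis of `F_i`, the basis
element `a` has degree `deg i a`, and `d i` is the matrix of the (degree preserving)
differential `F_{i+1} → F_i`. -/
structure GradedFreeComplex (σ k : Type*) [Field k] where
  ι : ℕ → Type
  fin : ∀ i, Fintype (ι i)
  deg : ∀ i, ι i → ℤ
  d : ∀ i, Matrix (ι i) (ι (i + 1)) (MvPolynomial σ k)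
  d_homog : ∀ i a b, d i a b ∈ homogPart σ k (deg (i + 1) b - deg i a)
  d_comp_d : ∀ i, d i * d (i + 1) = 0

attribute [instance] GradedFreeComplex.fin

namespace GradedFreeComplex

/-- The number of basis elements of degree `j` in homological degree `i`. -/
def gradedRank (F : GradedFreeComplex σ k) (i : ℕ) (j : ℤ) : ℕ :=
  Nat.card {a : F.ι i // F.deg i a = j}

/-- Minimality: all entries of the differentials lie in the ideal `𝔪 = (x_s : s ∈ σ)`. -/
def IsMinimal (F : GradedFreeComplex σ k) : Prop :=
  ∀ i a b, F.d i a b ∈ MvPolynomial.idealOfVars σ k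

/-- `F` together with the augmentation `F₀ → M`, given by the images `ε a` of the basis elements,
is a graded free resolution of the graded module `M = ⨁ ℳ j`. -/
structure IsResolution {M : Type*} [AddCommGroup M] [Module (MvPolynomial σ k) M] [Module k M]
    (ℳ : ℤ → Submodule k M) (F : GradedFreeComplex σ k) (ε : F.ι 0 → M) : Prop where
  aug_mem : ∀ a, ε a ∈ ℳ (F.deg 0 a)
  aug_surjective : Function.Surjective (Fintype.linearCombination (MvPolynomial σ k) ε)
  exact_zero : Function.Exact (F.d 0).mulVecLin (Fintype.linearCombination (MvPolynomial σ k) ε)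
  exact_succ : ∀ i, Function.Exact (F.d (i + 1)).mulVecLin (F.d i).mulVecLin

/-- `F` with augmentation `ε` is a minimal graded free resolution of `M = ⨁ ℳ j`. -/
def IsMinimalResolution {M : Type*} [AddCommGroup M] [Module (MvPolynomial σ k) M] [Module k M]
    (ℳ : ℤ → Submodule k M) (F : GradedFreeComplex σ k) (ε : F.ι 0 → M) : Prop :=
  IsResolution ℳ F ε ∧ F.IsMinimal

/-- The shifted complex `F(-e)`. -/
def shift (F : GradedFreeComplex σ k) (e : ℤ) : GradedFreeComplex σ k where
  ι := F.ι
  fin := F.fin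
  deg i a := F.deg i a + e
  d := F.d
  d_homog i a b := by
    rw [add_sub_add_right_eq_sub]
    exact F.d_homog i a b
  d_comp_d := F.d_comp_d

/-- Degree preserving chain maps `G → F`. -/
structure Hom (G F : GradedFreeComplex σ k) where
  f : ∀ i, Matrix (F.ι i) (G.ι i) (MvPolynomial σ k)
  f_homog : ∀ i a b, f i a b ∈ homogPart σ k (G.deg i b - F.deg i a)
  comm : ∀ i, f i * G.d i = F.d i * f (i + 1)

section Cone

variable {G F : GradedFreeComplex σ k}

/-- Basis of `F_i ⊕ G_{i-1}` (with `G_{-1} = 0`). -/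
def coneι (G F : GradedFreeComplex σ k) : ℕ → Type
  | 0 => F.ι 0
  | i + 1 => F.ι (i + 1) ⊕ G.ι i

instance coneFintype (G F : GradedFreeComplex σ k) : ∀ i, Fintype (coneι G F i)
  | 0 => F.fin 0
  | i + 1 => inferInstanceAs (Fintype (F.ι (i + 1) ⊕ G.ι i))

/-- Degrees of the basis of `F_i ⊕ G_{i-1}`. -/
def coneDeg (G F : GradedFreeComplex σ k) : ∀ i, coneι G F i → ℤ
  | 0 => F.deg 0
  | i + 1 => Sum.elim (F.deg (i + 1)) (G.deg i)

/-- The differential `(x, y) ↦ (ψ y + δ x, - d y)` of the mapping cone. -/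
def coneD (ψ : Hom G F) : ∀ i, Matrix (coneι G F i) (coneι G F (i + 1)) (MvPolynomial σ k)
  | 0 => Matrix.fromCols (F.d 0) (ψ.f 0)
  | i + 1 => Matrix.fromBlocks (F.d (i + 1)) (ψ.f (i + 1)) 0 (-(G.d i))

/-- The mapping cone of `ψ : G → F`. -/
def cone (ψ : Hom G F) : GradedFreeComplex σ k where
  ι := coneι G F
  fin := coneFintype G F
  deg := coneDeg G F
  d := coneD ψ
  d_homog := by
    rintro (_ | i)
    · rintro a (b | b)
      · exact F.d_homog 0 a b
      · exact ψ.f_homog 0 a b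
    · rintro (a | a) (b | b)
      · exact F.d_homog (i + 1) a b
      · exact ψ.f_homog (i + 1) a b
      · exact Submodule.zero_mem _
      · exact Submodule.neg_mem _ (G.d_homog i a b)
  d_comp_d := by
    rintro (_ | i)
    · change Matrix.fromCols (F.d 0) (ψ.f 0) *
        Matrix.fromBlocks (F.d 1) (ψ.f 1) 0 (-(G.d 0)) = 0
      rw [Matrix.fromCols_mul_fromBlocks, F.d_comp_d, ← ψ.comm]
      simp
    · change Matrix.fromBlocks (F.d (i + 1)) (ψ.f (i + 1)) 0 (-(G.d i)) *
        Matrix.fromBlocks (F.d (i + 2)) (ψ.f (i + 2)) 0 (-(G.d (i + 1))) = 0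
      rw [Matrix.fromBlocks_multiply, F.d_comp_d, ← ψ.comm]
      simp [G.d_comp_d]

end Cone

end GradedFreeComplex

open GradedFreeComplex

/-- Multiplication by `f` as a map `R ⧸ (I : f) → R ⧸ I`. -/
def colonMul (I : Ideal (MvPolynomial σ k)) (f : MvPolynomial σ k) :
    (MvPolynomial σ k ⧸ I.colon {f}) →ₗ[MvPolynomial σ k] (MvPolynomial σ k ⧸ I) :=
  Submodule.mapQ (I.colon {f}) I (LinearMap.mulRight (MvPolynomial σ k) f)
    (fun _ hr => Submodule.mem_colon_singleton.1 hr)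

/-- The ideal generated by the monomials with exponent vectors in the list `l`. -/
def monomialIdeal (k : Type*) [Field k] (l : List (σ →₀ ℕ)) : Ideal (MvPolynomial σ k) :=
  Ideal.span {p | ∃ a ∈ l, p = MvPolynomial.monomial a 1}

/-- The exponent vectors of the minimal monomial generators of a monomial ideal `I`:
the monomials of `I` that are minimal with respect to divisibility. -/
def minimalGenerators (I : Ideal (MvPolynomial σ k)) : Set (σ →₀ ℕ) :=
  {a | Minimal (fun b => MvPolynomial.monomial b (1 : k) ∈ I) a}

/-- The list `l` enumerates, without repetition, the minimal monomial generators of `I`. -/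
def IsGeneratorOrder (I : Ideal (MvPolynomial σ k)) (l : List (σ →₀ ℕ)) : Prop :=
  l.Nodup ∧ ∀ a, a ∈ l ↔ a ∈ minimalGenerators I

/-- `I` is a monomial ideal, with minimal generators `u_1, …, u_m` (the list `l`), and it is of
decreasing type with respect to this order of the generators: for each `j` there is a variable
`x_i ∈ supp(u_j)` with `deg_{x_i}(u_j) > deg_{x_i}(u_r)` for all `r < j`. -/
structure IsDecreasingType (I : Ideal (MvPolynomial σ k)) (l : List (σ →₀ ℕ)) : Prop where
  order : IsGeneratorOrder I l
  eq_monomialIdeal : I = monomialIdeal k l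
  decreasing : ∀ j : Fin l.length, ∃ i ∈ (l.get j).support,
    ∀ r : Fin l.length, r < j → (l.get r) i < (l.get j) i

/-- `C`, with augmentation `C₀ → R ⧸ I`, is obtained by the iterated mapping cone construction
along the list `l = u_1, …, u_m` of monomials generating `I`. One starts with the minimal graded
free resolution of `R ⧸ (0)`. Given the complex `F` obtained from `u_1, …, u_{j-1}`, with
augmentation to `R ⧸ I_{j-1}`, and a minimal graded free resolution `G` of `R ⧸ (I_{j-1} : u_j)`,
one takes the mapping cone of a degree preserving chain map `G(-deg u_j) → F` which lifts the
multiplication `u_j : R ⧸ (I_{j-1} : u_j) (-deg u_j) → R ⧸ I_{j-1}`; the augmentation of the cone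
is the composite of the one of `F` with `R ⧸ I_{j-1} → R ⧸ I_j`, where `I_j = I_{j-1} + (u_j)`. -/
inductive IsIteratedMappingCone :
    List (σ →₀ ℕ) → (I : Ideal (MvPolynomial σ k)) → (C : GradedFreeComplex σ k) →
      (C.ι 0 → MvPolynomial σ k ⧸ I) → Prop
  | nil (F : GradedFreeComplex σ k) (ε : F.ι 0 → MvPolynomial σ k ⧸ (⊥ : Ideal (MvPolynomial σ k)))
      (hF : IsMinimalResolution (quotientGrading ⊥) F ε) : IsIteratedMappingCone [] ⊥ F ε
  | snoc (l : List (σ →₀ ℕ)) (u : σ →₀ ℕ) (I J : Ideal (MvPolynomial σ k))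
      (hJ : J = I ⊔ Ideal.span {MvPolynomial.monomial u 1})
      (F : GradedFreeComplex σ k) (ε : F.ι 0 → MvPolynomial σ k ⧸ I)
      (hF : IsIteratedMappingCone l I F ε)
      (G : GradedFreeComplex σ k)
      (η : G.ι 0 → MvPolynomial σ k ⧸ I.colon {MvPolynomial.monomial u (1 : k)})
      (hG : IsMinimalResolution
        (quotientGrading (I.colon {MvPolynomial.monomial u (1 : k)})) G η)
      (ψ : Hom (G.shift (u.degree : ℤ)) F)
      (hψ : ∀ b : G.ι 0, Fintype.linearCombination (MvPolynomial σ k) ε (fun a => ψ.f 0 a b) =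
        colonMul I (MvPolynomial.monomial u 1) (η b)) :
      IsIteratedMappingCone (l ++ [u]) J (cone ψ)
        (fun a => Ideal.Quotient.factor (hJ ▸ le_sup_left : I ≤ J) (ε a))

section Invariants

variable {M : Type*} [AddCommGroup M] [Module (MvPolynomial σ k) M] [Module k M]

open Classical in
/-- The graded Betti number `β_{i,j}(M)`: the number of basis elements of degree `j` in
homological degree `i` of a minimal graded free resolution of `M = ⨁ ℳ j` (which is unique up to
isomorphism). -/
def gradedBetti (ℳ : ℤ → Submodule k M) (i : ℕ) (j : ℤ) : ℕ :=
  if h : ∃ (F : GradedFreeComplex σ k) (ε : F.ι 0 → M), IsMinimalResolution ℳ F ε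
  then h.choose.gradedRank i j else 0

/-- The total Betti number `β_i(M) = ∑_j β_{i,j}(M)`. -/
def betti (σ : Type*) {k : Type*} [Field k] {M : Type*} [AddCommGroup M]
    [Module (MvPolynomial σ k) M] [Module k M] (ℳ : ℤ → Submodule k M) (i : ℕ) : ℕ :=
  ∑ᶠ j : ℤ, gradedBetti (σ := σ) ℳ i j

/-- `pd(M) = p`, where `pd(M) = max {i ; β_{i,j}(M) ≠ 0 for some j}`. -/
def HasProjDim (σ : Type*) {k : Type*} [Field k] {M : Type*} [AddCommGroup M]
    [Module (MvPolynomial σ k) M] [Module k M] (ℳ : ℤ → Submodule k M) (p : ℕ) : Prop :=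
  IsGreatest {i : ℕ | ∃ j : ℤ, gradedBetti (σ := σ) ℳ i j ≠ 0} p

/-- `reg(M) = r`, where `reg(M) = max {j - i ; β_{i,j}(M) ≠ 0}`. -/
def HasRegularity (σ : Type*) {k : Type*} [Field k] {M : Type*} [AddCommGroup M]
    [Module (MvPolynomial σ k) M] [Module k M] (ℳ : ℤ → Submodule k M) (r : ℤ) : Prop :=
  IsGreatest {s : ℤ | ∃ (i : ℕ) (j : ℤ), gradedBetti (σ := σ) ℳ i j ≠ 0 ∧ s = j - i} r

/-- The depth of an `R`-module, `R = k[x_s : s ∈ σ]`: the supremum of the lengths of the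
`M`-regular sequences contained in `𝔪 = (x_s : s ∈ σ)`. -/
def depth (σ k M : Type*) [Field k] [AddCommGroup M] [Module (MvPolynomial σ k) M] : ℕ∞ :=
  ⨆ rs ∈ {rs : List (MvPolynomial σ k) |
    (∀ r ∈ rs, r ∈ MvPolynomial.idealOfVars σ k) ∧ RingTheory.Sequence.IsRegular M rs},
    (rs.length : ℕ∞)

/-- A (finitely generated, graded) `R`-module is Cohen–Macaulay if its depth equals its
Krull dimension. -/
def IsCohenMacaulay (σ k M : Type*) [Field k] [AddCommGroup M]
    [Module (MvPolynomial σ k) M] : Prop :=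
  (depth σ k M : WithBot ℕ∞) = Module.supportDim (MvPolynomial σ k) M

end Invariants

end Algebra

/-! ## Rooted trees and max-path ideals -/

/-- A rooted tree on the vertex set `{1, …, n}` (indexed by `Fin n`). -/
structure RootedTree (n : ℕ) where
  graph : SimpleGraph (Fin n)
  isTree : graph.IsTree
  root : Fin n

namespace RootedTree

variable {n : ℕ} (T : RootedTree n)

/-- The directed edges `(x, y)` of `T`: edges, directed away from the root. -/
def Child (x y : Fin n) : Prop :=
  T.graph.Adj x y ∧ T.graph.dist T.root y = T.graph.dist T.root x + 1

/-- A leaf is a vertex without children. -/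
def IsLeaf (x : Fin n) : Prop := ∀ y, ¬ T.Child x y

/-- The number of leaves. -/
def numLeaves : ℕ := Nat.card {x : Fin n // T.IsLeaf x}

/-- Directed paths: sequences of distinct vertices, consecutive ones joined by directed edges. -/
def IsDirectedPath (l : List (Fin n)) : Prop := l.Nodup ∧ l.IsChain T.Child

/-- Maximal paths: directed paths from the root to a leaf. -/
def IsMaximalPath (l : List (Fin n)) : Prop :=
  T.IsDirectedPath l ∧ l.head? = some T.root ∧ ∃ x, T.IsLeaf x ∧ l.getLast? = some x

/-- `T` itself is a directed path `e 0 → e 1 → ⋯ → e (n-1)`. -/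
def IsPath : Prop :=
  ∃ e : Fin n ≃ Fin n, ∀ a b : Fin n, T.Child (e a) (e b) ↔ (a : ℕ) + 1 = b

/-- The max-path ideal `PI(T)` in `k[x_1, …, x_n]`. -/
def maxPathIdeal (k : Type*) [Field k] : Ideal (MvPolynomial (Fin n) k) :=
  Ideal.span {p | ∃ l : List (Fin n), T.IsMaximalPath l ∧
    p = (l.map (MvPolynomial.X (R := k))).prod}

end RootedTree

end MaxPath

end

/-! The generators of the max-path ideal correspond to the leaves. A leaf on a directed path from
the root must be its end, so the variable of a leaf divides exactly one generator. This property,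
`HasPrivateVars`, does not depend on the order of the generators, and everything about resolutions
is proved for monomial lists that have it.

Let `x` be a private variable of the last generator `u`, and let `I` be generated by the others.
Since `x` occurs in none of them, `(I : u) ⊆ (I : u/x)`, so multiplication by `u` from `R/(I : u)`
to `R/I` is `x` times multiplication by `u/x`. If `f'` lifts the latter, `x • f'` lifts the former
and has entries in `𝔪`. Two lifts are homotopic, and between minimal complexes a homotopy changes
entries only by elements of `𝔪`. Hence every lift has entries in `𝔪` (`lift_colonMul_mem`) and every
cone is minimal, whatever resolutions and lifts were chosen
(`IsIteratedMappingCone.eq_and_isMinimalResolution`).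

The colon ideal is generated by the truncated differences `a - u`, which again have private
variables. So one induction on the number of generators (`exists_isIteratedMappingCone`) treats both
ends of the chain map: Pascal's rule gives binomial ranks, and the top basis element has the degree
of the lcm of the generators. That lcm is the product of all `n` variables, because each vertex lies
on a path to a leaf; this gives the regularity. Uniqueness of graded ranks (`gradedRank_eq`)
transfers the numbers to the Betti numbers, which are defined by a choice of resolution.

For the depth, the Auslander–Buchsbaum formula is obtained by diagram chases with the regular
sequence of the variables (`depth_eq_of_hasMinimalResolution`). The dimension is `n - 1` because the
nonzero ideal lies in the principal ideal of the root variable. Depth and dimension agree exactly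
when there is one leaf, that is, when the tree is a path. -/

noncomputable section
namespace MaxPath

/-! ### Free resolutions as matrices: comparison maps, homotopies and exactness of mapping cones. -/

section FreeResolutions

variable {R : Type*} [CommRing R]

/-- The complex of free modules with differentials `d`, augmented by `ε`, is a free resolution
of `M`. -/
structure IsFreeResolution {ι : ℕ → Type*} [∀ i, Fintype (ι i)]
    (d : ∀ i, Matrix (ι i) (ι (i + 1)) R)
    {M : Type*} [AddCommGroup M] [Module R M] (ε : ι 0 → M) : Prop where
  aug_surjective : Function.Surjective (Fintype.linearCombination R ε)
  exact_zero : Function.Exact (d 0).mulVecLin (Fintype.linearCombination R ε)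
  exact_succ : ∀ i, Function.Exact (d (i + 1)).mulVecLin (d i).mulVecLin

/-- Choosing the next term may require the relation between the two previous ones, as in the
construction of chain maps. The recursion therefore runs on pairs of consecutive terms together with
a proof of their relation. -/
theorem exists_seq_of_step {A : ℕ → Type*} (P : ∀ i, A i → A (i + 1) → Prop)
    (a₀ : A 0) (h₀ : ∃ a₁, P 0 a₀ a₁)
    (step : ∀ i a b, P i a b → ∃ c, P (i + 1) b c) :
    ∃ f : ∀ i, A i, f 0 = a₀ ∧ ∀ i, P i (f i) (f (i + 1)) := by
  choose a₁ h₁ using h₀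
  choose next hnext using step
  let s : ∀ i, {p : A i × A (i + 1) // P i p.1 p.2} := fun i =>
    Nat.rec ⟨(a₀, a₁), h₁⟩
      (fun i q => ⟨(q.1.2, next i q.1.1 q.1.2 q.2), hnext i q.1.1 q.1.2 q.2⟩) i
  exact ⟨fun i => (s i).1.1, rfl, fun i => (s i).2⟩

/-- Projectivity of free modules in matrix form: each column of `C` is a cycle and is lifted
separately. -/
theorem exists_mul_eq_of_exact {a b c e : Type*} [Fintype a] [Fintype b] [Fintype c]
    {A : Matrix b c R} {B : Matrix a b R} (h : Function.Exact A.mulVecLin B.mulVecLin)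
    (C : Matrix b e R) (hC : B * C = 0) : ∃ D : Matrix c e R, A * D = C := by
  have : ∀ j : e, ∃ y : c → R, A.mulVecLin y = C.col j := fun j => by
    apply (h _).1
    have := congrArg (fun X => X.col j) hC
    ext i
    simpa [Matrix.mulVec, Matrix.mul_apply, dotProduct] using congrFun this i
  choose y hy using this
  refine ⟨Matrix.of fun i j => y j i, ?_⟩
  ext i j
  simpa [Matrix.mulVec, Matrix.mul_apply, dotProduct] using congrFun (hy j) i

section Aug
variable {M : Type*} [AddCommGroup M] [Module R M]

theorem linearCombination_mulVec {a b : Type*} [Fintype a] [Fintype b] (ε : a → M)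
    (f : Matrix a b R) (x : b → R) :
    Fintype.linearCombination R ε (f.mulVec x) =
      Fintype.linearCombination R (fun j => Fintype.linearCombination R ε (fun i => f i j)) x := by
  simp only [Fintype.linearCombination_apply, Matrix.mulVec, dotProduct, Finset.sum_smul,
    Finset.smul_sum, smul_smul]
  rw [Finset.sum_comm]
  simp only [mul_comm]

theorem linearCombination_map {N : Type*} [AddCommGroup N] [Module R N] {a : Type*} [Fintype a]
    (ε : a → M) (g : M →ₗ[R] N) (x : a → R) :
    Fintype.linearCombination R (fun i => g (ε i)) x = g (Fintype.linearCombination R ε x) := by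
  simp [Fintype.linearCombination_apply]

theorem exists_aug_mul_eq {a b e : Type*} [Fintype a] [Fintype b] {A : Matrix a b R}
    {ε : a → M} (h : Function.Exact A.mulVecLin (Fintype.linearCombination R ε))
    (C : Matrix a e R) (hC : ∀ j, Fintype.linearCombination R ε (fun i => C i j) = 0) :
    ∃ D : Matrix b e R, A * D = C := by
  have : ∀ j : e, ∃ y : b → R, A.mulVecLin y = C.col j := fun j => (h _).1 (hC j)
  choose y hy using this
  refine ⟨Matrix.of fun i j => y j i, ?_⟩
  ext i j
  simpa [Matrix.mulVec, Matrix.mul_apply, dotProduct] using congrFun (hy j) i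

end Aug

variable {ι κ : ℕ → Type*} [∀ i, Fintype (ι i)] [∀ i, Fintype (κ i)]
  {d : ∀ i, Matrix (ι i) (ι (i + 1)) R} {e : ∀ i, Matrix (κ i) (κ (i + 1)) R}
  {M N : Type*} [AddCommGroup M] [Module R M] [AddCommGroup N] [Module R N]
  {ε : ι 0 → M} {η : κ 0 → N}

theorem IsFreeResolution.d_comp_d (h : IsFreeResolution d ε) (i : ℕ) : d i * d (i + 1) = 0 := by
  classical
  apply Matrix.ext_of_mulVec_single
  intro j
  have := (h.exact_succ i).apply_apply_eq_zero (Pi.single j 1)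
  rw [Matrix.mulVecLin_apply, Matrix.mulVecLin_apply, Matrix.mulVec_mulVec] at this
  rw [this, Matrix.zero_mulVec]

theorem IsFreeResolution.aug_d (h : IsFreeResolution d ε) (j : ι 1) :
    Fintype.linearCombination R ε (fun i => d 0 i j) = 0 := by
  classical
  have := h.exact_zero.apply_apply_eq_zero (Pi.single j 1)
  rw [Matrix.mulVecLin_apply, Matrix.mulVec_single_one] at this
  exact this

/-- Comparison theorem: a linear map lifts to a chain map of free resolutions. -/
theorem exists_lift (hd : IsFreeResolution d ε) (he : IsFreeResolution e η) (g : N →ₗ[R] M) :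
    ∃ f : ∀ i, Matrix (ι i) (κ i) R,
      (∀ b, Fintype.linearCombination R ε (fun a => f 0 a b) = g (η b)) ∧
      ∀ i, f i * e i = d i * f (i + 1) := by
  choose f₀ hf₀ using fun b => hd.aug_surjective (g (η b))
  obtain ⟨f, hf, hc⟩ := exists_seq_of_step
    (A := fun i => Matrix (ι i) (κ i) R) (fun i x y => x * e i = d i * y)
    (Matrix.of fun a b => f₀ b a)
    (by
      obtain ⟨D, hD⟩ := exists_aug_mul_eq hd.exact_zero ((Matrix.of fun a b => f₀ b a) * e 0)
        (by
          intro j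
          have h1 := linearCombination_mulVec (R := R) ε (Matrix.of fun a b => f₀ b a)
            (fun i => e 0 i j)
          have h2 := linearCombination_map (R := R) η g (fun i => e 0 i j)
          rw [he.aug_d, map_zero] at h2
          simp only [Matrix.of_apply] at h1
          simp only [hf₀] at h1
          rw [h2] at h1
          exact h1)
      exact ⟨D, hD.symm⟩)
    (by
      intro i x y hxy
      obtain ⟨D, hD⟩ := exists_mul_eq_of_exact (hd.exact_succ i) (y * e (i + 1))
        (by rw [← Matrix.mul_assoc, ← hxy, Matrix.mul_assoc, he.d_comp_d, Matrix.mul_zero])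
      exact ⟨D, hD.symm⟩)
  refine ⟨f, fun b => ?_, hc⟩
  rw [hf]
  exact hf₀ b

/-- A chain map lifting zero is null-homotopic. -/
theorem exists_homotopy (hd : IsFreeResolution d ε) (he : IsFreeResolution e η)
    (f : ∀ i, Matrix (ι i) (κ i) R)
    (hf : ∀ b, Fintype.linearCombination R ε (fun a => f 0 a b) = 0)
    (hc : ∀ i, f i * e i = d i * f (i + 1)) :
    ∃ h : ∀ i, Matrix (ι (i + 1)) (κ i) R, f 0 = d 0 * h 0 ∧
      ∀ i, f (i + 1) = d (i + 1) * h (i + 1) + h i * e i := by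
  obtain ⟨h₀, hh₀⟩ := exists_aug_mul_eq hd.exact_zero (f 0) hf
  obtain ⟨h, hz, hs⟩ := exists_seq_of_step
    (A := fun i => Matrix (ι (i + 1)) (κ i) R)
    (fun i x y => f (i + 1) = d (i + 1) * y + x * e i) h₀
    (by
      obtain ⟨D, hD⟩ := exists_mul_eq_of_exact (hd.exact_succ 0) (f 1 - h₀ * e 0)
        (by rw [Matrix.mul_sub, ← Matrix.mul_assoc, hh₀, hc, sub_self])
      exact ⟨D, by rw [hD, sub_add_cancel]⟩)
    (by
      intro i x y hxy
      obtain ⟨D, hD⟩ := exists_mul_eq_of_exact (hd.exact_succ (i + 1)) (f (i + 2) - y * e (i + 1))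
        (by
          rw [Matrix.mul_sub, ← hc, hxy, ← Matrix.mul_assoc, Matrix.add_mul, Matrix.mul_assoc x,
            he.d_comp_d]
          simp)
      exact ⟨D, by rw [hD, sub_add_cancel]⟩)
  exact ⟨h, by rw [hz, hh₀], hs⟩

theorem mul_mem_of_left_mem {a b c : Type*} [Fintype b] (I : Ideal R) {A : Matrix a b R}
    (hA : ∀ i j, A i j ∈ I) (B : Matrix b c R) (i : a) (j : c) : (A * B) i j ∈ I := by
  rw [Matrix.mul_apply]
  exact I.sum_mem fun l _ => I.mul_mem_right _ (hA i l)

theorem mul_mem_of_right_mem {a b c : Type*} [Fintype b] (I : Ideal R) (A : Matrix a b R)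
    {B : Matrix b c R} (hB : ∀ i j, B i j ∈ I) (i : a) (j : c) : (A * B) i j ∈ I := by
  rw [Matrix.mul_apply]
  exact I.sum_mem fun l _ => I.mul_mem_left _ (hB l j)

/-- Two lifts of the same map between minimal resolutions agree modulo the ideal. -/
theorem sub_mem_of_lifts (I : Ideal R) (hd : IsFreeResolution d ε) (he : IsFreeResolution e η)
    (hdI : ∀ i a b, d i a b ∈ I) (heI : ∀ i a b, e i a b ∈ I)
    (f f' : ∀ i, Matrix (ι i) (κ i) R)
    (hf : ∀ b, Fintype.linearCombination R ε (fun a => f 0 a b) =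
      Fintype.linearCombination R ε (fun a => f' 0 a b))
    (hc : ∀ i, f i * e i = d i * f (i + 1)) (hc' : ∀ i, f' i * e i = d i * f' (i + 1))
    (i : ℕ) (a : ι i) (b : κ i) : f i a b - f' i a b ∈ I := by
  obtain ⟨h, h0, hs⟩ := exists_homotopy hd he (fun i => f i - f' i)
    (fun b => by
      have := map_sub (Fintype.linearCombination R ε) (fun a => f 0 a b) (fun a => f' 0 a b)
      rw [hf, sub_self] at this
      exact this)
    (fun i => by rw [Matrix.sub_mul, Matrix.mul_sub, hc, hc'])
  rw [← Matrix.sub_apply]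
  cases i with
  | zero =>
    change (f 0 - f' 0) a b ∈ I
    rw [show f 0 - f' 0 = _ from h0]
    exact mul_mem_of_left_mem I (hdI 0) _ _ _
  | succ i =>
    rw [show f (i + 1) - f' (i + 1) = _ from hs i]
    exact I.add_mem (mul_mem_of_left_mem I (hdI _) _ _ _) (mul_mem_of_right_mem I _ (heI _) _ _)

section Cone

variable {a₁ a₂ a₃ b₀ b₁ b₂ : Type*} [Fintype a₂] [Fintype a₃] [Fintype b₁] [Fintype b₂]

/-- The second component of a cycle is a cycle, hence equal to `E₁ z`. Correcting the first
component by `f₂ z` makes it a cycle for `D₁`, hence equal to `D₂ w`; the sign in the cone makes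
`(w, -z)` the preimage. -/
theorem cone_exact_succ {D₁ : Matrix a₁ a₂ R} {D₂ : Matrix a₂ a₃ R} {E₀ : Matrix b₀ b₁ R}
    {E₁ : Matrix b₁ b₂ R} {f₁ : Matrix a₁ b₁ R} {f₂ : Matrix a₂ b₂ R}
    (hD : Function.Exact D₂.mulVecLin D₁.mulVecLin)
    (hE : Function.Exact E₁.mulVecLin E₀.mulVecLin) (hc : f₁ * E₁ = D₁ * f₂) :
    Function.Exact (Matrix.fromBlocks D₂ f₂ 0 (-E₁)).mulVecLin
      (Matrix.fromBlocks D₁ f₁ 0 (-E₀)).mulVecLin := by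
  have hc' : ∀ z, f₁.mulVec (E₁.mulVec z) = D₁.mulVec (f₂.mulVec z) := fun z => by
    rw [Matrix.mulVec_mulVec, hc, Matrix.mulVec_mulVec]
  intro v
  simp only [Matrix.mulVecLin_apply, Matrix.fromBlocks_mulVec, Matrix.zero_mulVec, zero_add,
    Matrix.neg_mulVec, Set.mem_range]
  constructor
  · intro h
    have h1 : D₁.mulVec (v ∘ Sum.inl) + f₁.mulVec (v ∘ Sum.inr) = 0 := by
      ext i; exact congrFun h (Sum.inl i)
    have h2 : E₀.mulVec (v ∘ Sum.inr) = 0 := by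
      ext i; simpa using congrFun h (Sum.inr i)
    obtain ⟨z, hz⟩ := (hE _).1 h2
    have hz' : E₁.mulVec z = v ∘ Sum.inr := hz
    obtain ⟨w, hw⟩ := (hD (v ∘ Sum.inl + f₂.mulVec z)).1 (by
      rw [Matrix.mulVecLin_apply, Matrix.mulVec_add, ← hc', hz', h1])
    have hw' : D₂.mulVec w = _ := hw
    refine ⟨Sum.elim w (-z), ?_⟩
    ext (i | i)
    · simp [hw', Matrix.mulVec_neg]
    · simp [hz', Matrix.mulVec_neg]
  · rintro ⟨y, rfl⟩
    have h1 := hD.apply_apply_eq_zero (y ∘ Sum.inl)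
    have h2 := hE.apply_apply_eq_zero (y ∘ Sum.inr)
    simp only [Matrix.mulVecLin_apply] at h1 h2
    ext (i | i)
    · simp [Matrix.mulVec_add, Matrix.mulVec_neg, hc', h1]
    · simp [Matrix.mulVec_neg, h2]

/-- Here no differential forces the second component to be a cycle. Applying `ε` shows that `g`
kills its image in `N`, and injectivity of `g` does the rest. -/
theorem cone_exact_one [Fintype a₁] {D₁ : Matrix a₁ a₂ R} {D₂ : Matrix a₂ a₃ R} {ε : a₁ → M} {η : b₁ → N}
    {E₁ : Matrix b₁ b₂ R} {f₁ : Matrix a₁ b₁ R} {f₂ : Matrix a₂ b₂ R}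
    (hD : Function.Exact D₂.mulVecLin D₁.mulVecLin)
    (hε : Function.Exact D₁.mulVecLin (Fintype.linearCombination R ε))
    (hE : Function.Exact E₁.mulVecLin (Fintype.linearCombination R η))
    (g : N →ₗ[R] M) (hg : Function.Injective g)
    (hf : ∀ b, Fintype.linearCombination R ε (fun a => f₁ a b) = g (η b))
    (hc : f₁ * E₁ = D₁ * f₂) :
    Function.Exact (Matrix.fromBlocks D₂ f₂ 0 (-E₁)).mulVecLin
      (Matrix.fromCols D₁ f₁).mulVecLin := by
  have hc' : ∀ z, f₁.mulVec (E₁.mulVec z) = D₁.mulVec (f₂.mulVec z) := fun z => by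
    rw [Matrix.mulVec_mulVec, hc, Matrix.mulVec_mulVec]
  intro v
  simp only [Matrix.mulVecLin_apply, Matrix.fromBlocks_mulVec, Matrix.fromCols_mulVec,
    Matrix.zero_mulVec, zero_add, Matrix.neg_mulVec, Set.mem_range]
  constructor
  · intro h
    have h2 : Fintype.linearCombination R η (v ∘ Sum.inr) = 0 := by
      apply hg
      rw [map_zero, ← linearCombination_map]
      simp only [← hf]
      rw [← linearCombination_mulVec]
      have h3 := congrArg (Fintype.linearCombination R ε) h
      have h4 := hε.apply_apply_eq_zero (v ∘ Sum.inl)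
      rw [Matrix.mulVecLin_apply] at h4
      rwa [map_add, h4, zero_add, map_zero] at h3
    obtain ⟨z, hz⟩ := (hE _).1 h2
    have hz' : E₁.mulVec z = v ∘ Sum.inr := hz
    obtain ⟨w, hw⟩ := (hD (v ∘ Sum.inl + f₂.mulVec z)).1 (by
      rw [Matrix.mulVecLin_apply, Matrix.mulVec_add, ← hc', hz', h])
    have hw' : D₂.mulVec w = _ := hw
    refine ⟨Sum.elim w (-z), ?_⟩
    ext (i | i)
    · simp [hw', Matrix.mulVec_neg]
    · simp [hz', Matrix.mulVec_neg]
  · rintro ⟨y, rfl⟩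
    have h1 := hD.apply_apply_eq_zero (y ∘ Sum.inl)
    simp only [Matrix.mulVecLin_apply] at h1
    ext i
    simp [Matrix.mulVec_add, Matrix.mulVec_neg, hc', h1]

theorem cone_exact_zero [Fintype a₁] {L : Type*} [AddCommGroup L] [Module R L] {D₁ : Matrix a₁ a₂ R}
    {ε : a₁ → M} {η : b₁ → N} {f₁ : Matrix a₁ b₁ R}
    (hε : Function.Exact D₁.mulVecLin (Fintype.linearCombination R ε))
    (hη : Function.Surjective (Fintype.linearCombination R η))
    (g : N →ₗ[R] M) (q : M →ₗ[R] L) (hgq : Function.Exact g q)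
    (hf : ∀ b, Fintype.linearCombination R ε (fun a => f₁ a b) = g (η b)) :
    Function.Exact (Matrix.fromCols D₁ f₁).mulVecLin
      (Fintype.linearCombination R (fun a => q (ε a))) := by
  have hf' : ∀ y, Fintype.linearCombination R ε (f₁.mulVec y) =
      g (Fintype.linearCombination R η y) := fun y => by
    rw [linearCombination_mulVec, ← linearCombination_map]
    simp only [hf]
  intro v
  simp only [Matrix.mulVecLin_apply, Matrix.fromCols_mulVec, Set.mem_range, linearCombination_map]
  constructor
  · intro h
    obtain ⟨y, hy⟩ := (hgq _).1 h
    obtain ⟨y, rfl⟩ := hη y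
    obtain ⟨w, hw⟩ := (hε (v - f₁.mulVec y)).1 (by rw [map_sub, hf', hy, sub_self])
    have hw' : D₁.mulVec w = _ := hw
    refine ⟨Sum.elim w y, ?_⟩
    simp [hw']
  · rintro ⟨y, rfl⟩
    have h1 := hε.apply_apply_eq_zero (y ∘ Sum.inl)
    rw [Matrix.mulVecLin_apply] at h1
    rw [map_add, h1, zero_add, hf', hgq.apply_apply_eq_zero]

end Cone

end FreeResolutions
end MaxPath
end

/-! ### Graded lifts and uniqueness of graded ranks. -/

noncomputable section
namespace MaxPath

section Graded

variable {σ k : Type*} [Field k]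

/-- The homogeneous component of integer degree. -/
def homogComp (σ k : Type*) [Field k] : ℤ → MvPolynomial σ k →ₗ[k] MvPolynomial σ k
  | Int.ofNat d => MvPolynomial.homogeneousComponent d
  | Int.negSucc _ => 0

theorem homogComp_mem (j : ℤ) (p : MvPolynomial σ k) : homogComp σ k j p ∈ homogPart σ k j := by
  cases j with
  | ofNat d => exact MvPolynomial.homogeneousComponent_mem d p
  | negSucc d => exact Submodule.zero_mem _

theorem homogComp_of_mem {j : ℤ} {p : MvPolynomial σ k} (hp : p ∈ homogPart σ k j) :
    homogComp σ k j p = p := by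
  cases j with
  | ofNat d =>
    change p ∈ MvPolynomial.homogeneousSubmodule σ k d at hp
    change MvPolynomial.homogeneousComponent d p = p
    rw [MvPolynomial.homogeneousComponent_of_mem hp, if_pos rfl]
  | negSucc d => exact ((Submodule.mem_bot k).1 hp).symm

attribute [local instance] MvPolynomial.gradedAlgebra in
theorem coe_decompose_eq_homogeneousComponent (p : MvPolynomial σ k) (n : ℕ) :
    (DirectSum.decompose (MvPolynomial.homogeneousSubmodule σ k) p n : MvPolynomial σ k) =
      MvPolynomial.homogeneousComponent n p :=
  MvPolynomial.decomposition.decompose'_apply p n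

attribute [local instance] MvPolynomial.gradedAlgebra in
theorem homogComp_mul_of_left_mem {i : ℤ} {p : MvPolynomial σ k} (hp : p ∈ homogPart σ k i)
    (q : MvPolynomial σ k) (j : ℤ) :
    homogComp σ k j (p * q) = p * homogComp σ k (j - i) q := by
  cases i with
  | negSucc i => rw [(Submodule.mem_bot k).1 hp]; simp
  | ofNat i =>
    change p ∈ MvPolynomial.homogeneousSubmodule σ k i at hp
    cases j with
    | negSucc j =>
      have : Int.negSucc j - Int.ofNat i = Int.negSucc (j + i) := by
        simp only [Int.negSucc_eq, Int.ofNat_eq_natCast]; push_cast; ring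
      rw [this]; simp [homogComp]
    | ofNat j =>
      by_cases h : i ≤ j
      · have : Int.ofNat j - Int.ofNat i = Int.ofNat (j - i) := by
          simp only [Int.ofNat_eq_natCast]; omega
        rw [this]
        have := DirectSum.coe_decompose_mul_of_left_mem_of_le
          (MvPolynomial.homogeneousSubmodule σ k) (b := q) hp h
        rwa [coe_decompose_eq_homogeneousComponent, coe_decompose_eq_homogeneousComponent] at this
      · obtain ⟨l, hl⟩ : ∃ l, Int.ofNat j - Int.ofNat i = Int.negSucc l :=
          ⟨i - j - 1, by simp only [Int.negSucc_eq, Int.ofNat_eq_natCast]; omega⟩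
        rw [hl]
        have := DirectSum.coe_decompose_mul_of_left_mem_of_not_le
          (MvPolynomial.homogeneousSubmodule σ k) (b := q) hp h
        rw [coe_decompose_eq_homogeneousComponent] at this
        simp only [homogComp, LinearMap.zero_apply, mul_zero]
        exact this

theorem homogComp_mul_of_right_mem {i : ℤ} {p : MvPolynomial σ k} (hp : p ∈ homogPart σ k i)
    (q : MvPolynomial σ k) (j : ℤ) :
    homogComp σ k j (q * p) = homogComp σ k (j - i) q * p := by
  rw [mul_comm, homogComp_mul_of_left_mem hp, mul_comm]

theorem constantCoeff_eq_zero_of_mem_homogPart {j : ℤ} (hj : j ≠ 0) {p : MvPolynomial σ k}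
    (hp : p ∈ homogPart σ k j) : MvPolynomial.constantCoeff p = 0 := by
  cases j with
  | negSucc d => rw [(Submodule.mem_bot k).1 hp, map_zero]
  | ofNat d =>
    have hp' : p.IsHomogeneous d := hp
    rw [MvPolynomial.constantCoeff_eq]
    apply hp'.coeff_eq_zero
    simpa [eq_comm] using hj

theorem mem_idealOfVars_iff {p : MvPolynomial σ k} :
    p ∈ MvPolynomial.idealOfVars σ k ↔ MvPolynomial.constantCoeff p = 0 := by
  rw [← pow_one (MvPolynomial.idealOfVars σ k), MvPolynomial.mem_pow_idealOfVars_iff',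
    MvPolynomial.constantCoeff_eq]
  constructor
  · intro h; exact h 0 (by simp)
  · intro h x hx
    rw [Nat.lt_one_iff, Finsupp.degree_eq_zero_iff] at hx
    rw [hx, h]

/-- An ideal containing the homogeneous components of its elements. -/
def HomogClosed (I : Ideal (MvPolynomial σ k)) : Prop :=
  ∀ p ∈ I, ∀ j, homogComp σ k j p ∈ I

namespace GradedFreeComplex

theorem IsResolution.isFreeResolution {M : Type*} [AddCommGroup M] [Module (MvPolynomial σ k) M]
    [Module k M] {ℳ : ℤ → Submodule k M} {F : GradedFreeComplex σ k} {ε : F.ι 0 → M}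
    (h : IsResolution ℳ F ε) : IsFreeResolution F.d ε :=
  ⟨h.aug_surjective, h.exact_zero, h.exact_succ⟩

theorem exists_homogeneous_rep {I : Ideal (MvPolynomial σ k)} {j : ℤ}
    {x : MvPolynomial σ k ⧸ I} (hx : x ∈ quotientGrading I j) :
    ∃ p ∈ homogPart σ k j, Ideal.Quotient.mk I p = x := by
  obtain ⟨p, hp, rfl⟩ := hx
  exact ⟨p, hp, rfl⟩

/-- A homogeneous map to `R ⧸ I` lifts to a graded chain map of resolutions. -/
theorem exists_graded_lift {I : Ideal (MvPolynomial σ k)} (hI : HomogClosed I)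
    {N : Type*} [AddCommGroup N] [Module (MvPolynomial σ k) N] [Module k N]
    {𝒩 : ℤ → Submodule k N} {P Q : GradedFreeComplex σ k} {η : P.ι 0 → N}
    {ε : Q.ι 0 → MvPolynomial σ k ⧸ I}
    (hP : IsResolution 𝒩 P η) (hQ : IsResolution (quotientGrading I) Q ε)
    (g : N →ₗ[MvPolynomial σ k] MvPolynomial σ k ⧸ I) (e : ℤ)
    (hg : ∀ b, g (η b) ∈ quotientGrading I (P.deg 0 b + e)) :
    ∃ f : ∀ i, Matrix (Q.ι i) (P.ι i) (MvPolynomial σ k),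
      (∀ i a b, f i a b ∈ homogPart σ k (P.deg i b + e - Q.deg i a)) ∧
      (∀ i, f i * P.d i = Q.d i * f (i + 1)) ∧
      ∀ b, Fintype.linearCombination (MvPolynomial σ k) ε (fun a => f 0 a b) = g (η b) := by
  obtain ⟨f, hf, hc⟩ := exists_lift hQ.isFreeResolution hP.isFreeResolution g
  -- Each entry of an arbitrary lift is replaced by its component of the required degree. The
  -- differentials are homogeneous, so the chain map identities survive. For the augmentation, an
  -- identity modulo `I` passes to components because `I` contains the components of its elements.
  refine ⟨fun i => Matrix.of fun a b => homogComp σ k (P.deg i b + e - Q.deg i a) (f i a b),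
    fun i a b => homogComp_mem _ _, fun i => ?_, fun b => ?_⟩
  · ext a b : 1
    have h := congrArg (homogComp σ k (P.deg (i + 1) b + e - Q.deg i a))
      (congrFun (congrFun (hc i) a) b)
    rw [Matrix.mul_apply, Matrix.mul_apply, map_sum, map_sum] at h
    rw [Matrix.mul_apply, Matrix.mul_apply]
    refine Eq.trans (Finset.sum_congr rfl fun c _ => ?_)
      (h.trans (Finset.sum_congr rfl fun c _ => ?_))
    · rw [homogComp_mul_of_right_mem (P.d_homog i c b),
        show P.deg (i + 1) b + e - Q.deg i a - (P.deg (i + 1) b - P.deg i c) =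
        P.deg i c + e - Q.deg i a by ring]
      rfl
    · rw [homogComp_mul_of_left_mem (Q.d_homog i a c),
        show P.deg (i + 1) b + e - Q.deg i a - (Q.deg (i + 1) c - Q.deg i a) =
        P.deg (i + 1) b + e - Q.deg (i + 1) c by ring]
      rfl
  · choose r hr hr' using fun a => exists_homogeneous_rep (hQ.aug_mem a)
    obtain ⟨s, hs, hs'⟩ := exists_homogeneous_rep (hg b)
    have h1 := hf b
    have key : ∀ x : Q.ι 0 → MvPolynomial σ k,
        Fintype.linearCombination (MvPolynomial σ k) ε x =
          Ideal.Quotient.mk I (∑ a, x a * r a) := fun x => by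
      rw [Fintype.linearCombination_apply, map_sum]
      refine Finset.sum_congr rfl fun a _ => ?_
      rw [map_mul, hr']
      rfl
    rw [key, ← hs', Ideal.Quotient.eq] at h1
    rw [key, ← hs', Ideal.Quotient.eq]
    have h2 := hI _ h1 (P.deg 0 b + e)
    rw [map_sub, homogComp_of_mem hs, map_sum] at h2
    convert h2 using 3 with a _
    rw [homogComp_mul_of_right_mem (hr a)]
    rfl

/-- Both `ψ φ` and the identity lift the identity of `R ⧸ I`, so they agree modulo `𝔪`, that is, in
their constant terms. -/
theorem constantCoeff_mul_sub_one_of_lifts {I : Ideal (MvPolynomial σ k)}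
    {P Q : GradedFreeComplex σ k} {ε : P.ι 0 → MvPolynomial σ k ⧸ I}
    (hP : IsMinimalResolution (quotientGrading I) P ε) {η : Q.ι 0 → MvPolynomial σ k ⧸ I}
    (φ : ∀ i, Matrix (Q.ι i) (P.ι i) (MvPolynomial σ k))
    (ψ : ∀ i, Matrix (P.ι i) (Q.ι i) (MvPolynomial σ k))
    (hφc : ∀ i, φ i * P.d i = Q.d i * φ (i + 1)) (hψc : ∀ i, ψ i * Q.d i = P.d i * ψ (i + 1))
    (hφ : ∀ b, Fintype.linearCombination (MvPolynomial σ k) η (fun a => φ 0 a b) = ε b)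
    (hψ : ∀ b, Fintype.linearCombination (MvPolynomial σ k) ε (fun a => ψ 0 a b) = η b)
    [∀ i, DecidableEq (P.ι i)] (i : ℕ) (a b : P.ι i) :
    ∑ c, MvPolynomial.constantCoeff (ψ i a c) * MvPolynomial.constantCoeff (φ i c b) =
      if a = b then 1 else 0 := by
  have h := sub_mem_of_lifts (MvPolynomial.idealOfVars σ k) hP.1.isFreeResolution
    hP.1.isFreeResolution hP.2 hP.2 (fun i => ψ i * φ i) (fun i => 1)
    (fun b => by
      have h1 := linearCombination_mulVec ε (ψ 0) (fun c => φ 0 c b)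
      simp only [hψ, hφ] at h1
      have h2 : (fun a => (1 : Matrix (P.ι 0) (P.ι 0) (MvPolynomial σ k)) a b) =
          Pi.single b 1 := by
        ext a; rw [Matrix.one_apply, Pi.single_apply]
      rw [h2, Fintype.linearCombination_apply_single, one_smul]
      exact h1)
    (fun i => by
      rw [Matrix.mul_assoc, hφc, ← Matrix.mul_assoc, hψc, Matrix.mul_assoc])
    (fun i => by rw [Matrix.one_mul, Matrix.mul_one]) i a b
  rw [mem_idealOfVars_iff, map_sub, sub_eq_zero, Matrix.mul_apply, map_sum] at h
  simp only [map_mul] at h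
  rw [h, Matrix.one_apply]
  convert apply_ite _ _ _ _ <;> simp

theorem _root_.Finset.sum_subtype_of_ne_zero {α β : Type*} [Fintype α] [AddCommMonoid β]
    (p : α → Prop) [DecidablePred p] {f : α → β} (hf : ∀ x, f x ≠ 0 → p x) :
    ∑ x : {x // p x}, f x = ∑ x, f x := by
  rw [← Finset.sum_filter_of_ne (p := p) fun x _ hx => hf x hx]
  exact (Finset.sum_subtype _ (fun x => by simp) f).symm

/-- The graded ranks of a minimal graded free resolution of `R ⧸ I` are unique. -/
theorem gradedRank_eq {I : Ideal (MvPolynomial σ k)} (hI : HomogClosed I)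
    {P Q : GradedFreeComplex σ k} {ε : P.ι 0 → MvPolynomial σ k ⧸ I}
    (hP : IsMinimalResolution (quotientGrading I) P ε) {η : Q.ι 0 → MvPolynomial σ k ⧸ I}
    (hQ : IsMinimalResolution (quotientGrading I) Q η) (i : ℕ) (j : ℤ) :
    P.gradedRank i j = Q.gradedRank i j := by
  classical
  obtain ⟨φ, hφh, hφc, hφ⟩ := exists_graded_lift hI hP.1 hQ.1 LinearMap.id 0
    (fun b => by simpa using hP.1.aug_mem b)
  obtain ⟨ψ, hψh, hψc, hψ⟩ := exists_graded_lift hI hQ.1 hP.1 LinearMap.id 0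
    (fun b => by simpa using hQ.1.aug_mem b)
  have h1 := constantCoeff_mul_sub_one_of_lifts hP φ ψ hφc hψc hφ hψ i
  have h2 := constantCoeff_mul_sub_one_of_lifts hQ ψ φ hψc hφc hψ hφ i
  have hφ0 : ∀ a b, P.deg i b ≠ Q.deg i a → MvPolynomial.constantCoeff (φ i a b) = 0 :=
    fun a b hab => constantCoeff_eq_zero_of_mem_homogPart (j := P.deg i b + 0 - Q.deg i a)
      (by rw [add_zero]; exact sub_ne_zero.2 hab) (hφh i a b)
  have hψ0 : ∀ a b, Q.deg i b ≠ P.deg i a → MvPolynomial.constantCoeff (ψ i a b) = 0 :=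
    fun a b hab => constantCoeff_eq_zero_of_mem_homogPart (j := Q.deg i b + 0 - P.deg i a)
      (by rw [add_zero]; exact sub_ne_zero.2 hab) (hψh i a b)
  rw [gradedRank, gradedRank, Nat.card_eq_fintype_card, Nat.card_eq_fintype_card]
  -- An entry of nonzero degree has no constant term, so modulo `𝔪` the comparison maps are block
  -- diagonal with respect to degree. The degree `j` blocks are mutually inverse, hence square.
  let A : Matrix {a : Q.ι i // Q.deg i a = j} {a : P.ι i // P.deg i a = j} k :=
    Matrix.of fun a b => MvPolynomial.constantCoeff (φ i a b)
  let B : Matrix {a : P.ι i // P.deg i a = j} {a : Q.ι i // Q.deg i a = j} k :=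
    Matrix.of fun a b => MvPolynomial.constantCoeff (ψ i a b)
  have hBA : B * A = 1 := by
    ext a b
    rw [Matrix.mul_apply, Matrix.one_apply]
    simp only [Subtype.ext_iff]
    rw [← h1 a b, ← Finset.sum_subtype_of_ne_zero (fun c => Q.deg i c = j)]
    · rfl
    · intro c hc
      by_contra hne
      exact hc (by rw [hφ0 c b (by rw [b.2]; exact fun h => hne h.symm), mul_zero])
  have hAB : A * B = 1 := by
    ext a b
    rw [Matrix.mul_apply, Matrix.one_apply]
    simp only [Subtype.ext_iff]
    rw [← h2 a b, ← Finset.sum_subtype_of_ne_zero (fun c => P.deg i c = j)]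
    · rfl
    · intro c hc
      by_contra hne
      exact hc (by rw [hψ0 c b (by rw [b.2]; exact fun h => hne h.symm), mul_zero])
  exact Matrix.square_of_invertible B A hBA hAB

theorem gradedBetti_eq {I : Ideal (MvPolynomial σ k)} (hI : HomogClosed I)
    {P : GradedFreeComplex σ k} {ε : P.ι 0 → MvPolynomial σ k ⧸ I}
    (hP : IsMinimalResolution (quotientGrading I) P ε) (i : ℕ) (j : ℤ) :
    gradedBetti (σ := σ) (quotientGrading I) i j = P.gradedRank i j := by
  have h : ∃ (F : GradedFreeComplex σ k) (ε : F.ι 0 → MvPolynomial σ k ⧸ I),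
      IsMinimalResolution (quotientGrading I) F ε := ⟨P, ε, hP⟩
  obtain ⟨η, hη⟩ := h.choose_spec
  rw [gradedBetti, dif_pos h]
  exact gradedRank_eq hI hη hP i j

theorem finsum_gradedRank (P : GradedFreeComplex σ k) (i : ℕ) :
    ∑ᶠ j : ℤ, P.gradedRank i j = Fintype.card (P.ι i) := by
  classical
  have h : ∀ j, P.gradedRank i j = (Finset.univ.filter fun a => P.deg i a = j).card := fun j => by
    rw [gradedRank, Nat.card_eq_fintype_card, Fintype.card_subtype]
  simp only [h]
  rw [finsum_eq_sum_of_support_subset (s := Finset.univ.image (P.deg i)), ← Finset.card_univ]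
  · exact (Finset.card_eq_sum_card_fiberwise fun a _ =>
      Finset.mem_coe.2 (Finset.mem_image_of_mem _ (Finset.mem_univ a))).symm
  · intro j hj
    obtain ⟨a, ha⟩ := Finset.card_ne_zero.1 hj
    exact Finset.mem_coe.2 (Finset.mem_image.2 ⟨a, Finset.mem_univ _, (Finset.mem_filter.1 ha).2⟩)

theorem betti_eq {I : Ideal (MvPolynomial σ k)} (hI : HomogClosed I)
    {P : GradedFreeComplex σ k} {ε : P.ι 0 → MvPolynomial σ k ⧸ I}
    (hP : IsMinimalResolution (quotientGrading I) P ε) (i : ℕ) :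
    betti σ (quotientGrading I) i = Fintype.card (P.ι i) := by
  rw [betti, ← finsum_gradedRank]
  simp only [gradedBetti_eq hI hP]

end GradedFreeComplex
end Graded
end MaxPath
end

/-! ### Monomial ideals, their colons, and iterated mapping cones. -/

noncomputable section
namespace MaxPath

section Monomial

variable {σ k : Type*} [Field k]

theorem mem_monomialIdeal {l : List (σ →₀ ℕ)} {p : MvPolynomial σ k} :
    p ∈ monomialIdeal k l ↔ ∀ s ∈ p.support, ∃ a ∈ l, a ≤ s := by
  have : monomialIdeal k l =
      Ideal.span ((fun s => MvPolynomial.monomial s (1 : k)) '' {a | a ∈ l}) := by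
    unfold monomialIdeal
    congr 1
    ext p
    simp only [Set.mem_ofPred_eq, Set.mem_image]
    exact exists_congr fun a => and_congr_right fun _ => eq_comm
  rw [this, MvPolynomial.mem_ideal_span_monomial_image]
  rfl

theorem monomial_mem_monomialIdeal {l : List (σ →₀ ℕ)} {s : σ →₀ ℕ} :
    MvPolynomial.monomial s (1 : k) ∈ monomialIdeal k l ↔ ∃ a ∈ l, a ≤ s := by
  classical
  rw [mem_monomialIdeal, MvPolynomial.support_monomial, if_neg one_ne_zero]
  simp

theorem monomialIdeal_nil : monomialIdeal k ([] : List (σ →₀ ℕ)) = ⊥ := by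
  simp [monomialIdeal]

theorem monomialIdeal_append_singleton (l : List (σ →₀ ℕ)) (u : σ →₀ ℕ) :
    monomialIdeal k (l ++ [u]) =
      monomialIdeal k l ⊔ Ideal.span {MvPolynomial.monomial u 1} := by
  rw [monomialIdeal, monomialIdeal, ← Ideal.span_union]
  congr 1
  ext p
  simp [or_and_right, exists_or, or_comm]

theorem homogClosed_monomialIdeal (l : List (σ →₀ ℕ)) : HomogClosed (monomialIdeal k l) := by
  classical
  intro p hp j
  cases j with
  | negSucc j => exact Ideal.zero_mem _
  | ofNat j =>
    rw [mem_monomialIdeal] at hp ⊢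
    intro s hs
    change s ∈ (MvPolynomial.homogeneousComponent j p).support at hs
    apply hp
    rw [MvPolynomial.mem_support_iff, MvPolynomial.coeff_homogeneousComponent] at hs
    rw [MvPolynomial.mem_support_iff]
    exact fun h => hs (by rw [h, ite_self])

theorem mul_monomial_mem_monomialIdeal {l : List (σ →₀ ℕ)} {u : σ →₀ ℕ} {p : MvPolynomial σ k} :
    p * MvPolynomial.monomial u 1 ∈ monomialIdeal k l ↔
      ∀ s ∈ p.support, ∃ a ∈ l, a ≤ s + u := by
  classical
  rw [mem_monomialIdeal]
  constructor
  · intro h s hs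
    apply h
    rw [MvPolynomial.mem_support_iff] at hs ⊢
    rwa [MvPolynomial.coeff_mul_monomial, mul_one]
  · intro h s hs
    rw [MvPolynomial.mem_support_iff, MvPolynomial.coeff_mul_monomial'] at hs
    split_ifs at hs with hus
    · obtain ⟨a, ha, has⟩ := h (s - u) (by rw [MvPolynomial.mem_support_iff]; simpa using hs)
      exact ⟨a, ha, by rwa [tsub_add_cancel_of_le hus] at has⟩
    · exact absurd rfl hs

theorem mem_colon_monomial {I : Ideal (MvPolynomial σ k)} {p f : MvPolynomial σ k} :
    p ∈ I.colon {f} ↔ p * f ∈ I := Submodule.mem_colon_singleton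

/-- Truncated subtraction is division by the gcd: `a ≤ s + u` if and only if `a - u ≤ s`. -/
theorem colon_monomialIdeal (l : List (σ →₀ ℕ)) (u : σ →₀ ℕ) :
    (monomialIdeal k l).colon {MvPolynomial.monomial u (1 : k)} =
      monomialIdeal k (l.map (· - u)) := by
  ext p
  rw [mem_colon_monomial, mul_monomial_mem_monomialIdeal, mem_monomialIdeal]
  simp [tsub_le_iff_right]

/-- Lowering the exponent of `x` in `u` by one still leaves at least `a x`, so any generator
dividing a multiple of `u` divides the corresponding multiple of `u/x`. -/
theorem colon_monomialIdeal_le {l : List (σ →₀ ℕ)} {u : σ →₀ ℕ} {x : σ}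
    (hx : ∀ a ∈ l, a x < u x) :
    (monomialIdeal k l).colon {MvPolynomial.monomial u (1 : k)} ≤
      (monomialIdeal k l).colon {MvPolynomial.monomial (u - Finsupp.single x 1) (1 : k)} := by
  classical
  intro p
  rw [mem_colon_monomial, mem_colon_monomial, mul_monomial_mem_monomialIdeal,
    mul_monomial_mem_monomialIdeal]
  intro h s hs
  obtain ⟨a, ha, has⟩ := h s hs
  refine ⟨a, ha, fun y => ?_⟩
  have h1 := has y
  have h2 := hx a ha
  simp only [Finsupp.add_apply, Finsupp.tsub_apply, Finsupp.single_apply] at h1 ⊢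
  split_ifs with hxy
  · subst hxy; omega
  · omega

theorem colonMul_mk (I : Ideal (MvPolynomial σ k)) (f p : MvPolynomial σ k) :
    colonMul I f (Ideal.Quotient.mk _ p) = Ideal.Quotient.mk I (p * f) := rfl

theorem colonMul_injective (I : Ideal (MvPolynomial σ k)) (f : MvPolynomial σ k) :
    Function.Injective (colonMul I f) := by
  rw [injective_iff_map_eq_zero]
  intro x hx
  obtain ⟨p, rfl⟩ := Ideal.Quotient.mk_surjective x
  rw [colonMul_mk, Ideal.Quotient.eq_zero_iff_mem] at hx
  exact Ideal.Quotient.eq_zero_iff_mem.2 (mem_colon_monomial.2 hx)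

/-- The projection `R ⧸ I → R ⧸ J` as a linear map. -/
def factorLinear {I J : Ideal (MvPolynomial σ k)} (h : I ≤ J) :
    (MvPolynomial σ k ⧸ I) →ₗ[MvPolynomial σ k] (MvPolynomial σ k ⧸ J) :=
  (Ideal.Quotient.factorₐ (MvPolynomial σ k) h).toLinearMap

theorem factorLinear_mk {I J : Ideal (MvPolynomial σ k)} (h : I ≤ J) (p : MvPolynomial σ k) :
    factorLinear h (Ideal.Quotient.mk I p) = Ideal.Quotient.mk J p := rfl

/-- With `colonMul_injective` this gives the short exact sequence `0 → R/(I : f) → R/I → R/J → 0`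
behind the mapping cone. -/
theorem exact_colonMul_factorLinear {I J : Ideal (MvPolynomial σ k)} {f : MvPolynomial σ k}
    (hJ : J = I ⊔ Ideal.span {f}) (h : I ≤ J) :
    Function.Exact (colonMul I f) (factorLinear h) := by
  intro x
  obtain ⟨p, rfl⟩ := Ideal.Quotient.mk_surjective x
  rw [factorLinear_mk, Ideal.Quotient.eq_zero_iff_mem, hJ]
  constructor
  · intro hp
    obtain ⟨a, ha, b, hb, rfl⟩ := Submodule.mem_sup.1 hp
    obtain ⟨c, rfl⟩ := Ideal.mem_span_singleton'.1 hb
    refine ⟨Ideal.Quotient.mk _ c, ?_⟩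
    rw [colonMul_mk, map_add, Ideal.Quotient.eq_zero_iff_mem.2 ha, zero_add]
  · rintro ⟨y, hy⟩
    obtain ⟨c, rfl⟩ := Ideal.Quotient.mk_surjective y
    rw [colonMul_mk, Ideal.Quotient.eq] at hy
    have : p = c * f - (c * f - p) := by ring
    rw [this]
    exact sub_mem (Submodule.mem_sup_right (Ideal.mul_mem_left _ _ (Ideal.mem_span_singleton_self f)))
      (Submodule.mem_sup_left hy)

namespace GradedFreeComplex

theorem cone_isResolution {I J : Ideal (MvPolynomial σ k)} {u : σ →₀ ℕ}
    (hJ : J = I ⊔ Ideal.span {MvPolynomial.monomial u 1}) (hIJ : I ≤ J)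
    {F G : GradedFreeComplex σ k} {ε : F.ι 0 → MvPolynomial σ k ⧸ I}
    (hF : IsResolution (quotientGrading I) F ε)
    {η : G.ι 0 → MvPolynomial σ k ⧸ I.colon {MvPolynomial.monomial u (1 : k)}}
    (hG : IsResolution (quotientGrading (I.colon {MvPolynomial.monomial u (1 : k)})) G η)
    (ψ : Hom (G.shift (u.degree : ℤ)) F)
    (hψ : ∀ b : G.ι 0, Fintype.linearCombination (MvPolynomial σ k) ε (fun a => ψ.f 0 a b) =
        colonMul I (MvPolynomial.monomial u 1) (η b)) :
    IsResolution (quotientGrading J) (cone ψ) (fun a => Ideal.Quotient.factor hIJ (ε a)) where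
  aug_mem a := by
    obtain ⟨p, hp, hp'⟩ := exists_homogeneous_rep (hF.aug_mem a)
    refine ⟨p, hp, ?_⟩
    change _ = Ideal.Quotient.factor hIJ (ε a)
    rw [← hp']
    rfl
  aug_surjective := by
    intro x
    obtain ⟨p, rfl⟩ := Ideal.Quotient.mk_surjective x
    obtain ⟨y, hy⟩ := hF.aug_surjective (Ideal.Quotient.mk I p)
    refine ⟨y, (linearCombination_map ε (factorLinear hIJ) y).trans ?_⟩
    rw [hy, factorLinear_mk]
  exact_zero :=
    cone_exact_zero hF.exact_zero hG.aug_surjective (colonMul I (MvPolynomial.monomial u 1))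
      (factorLinear hIJ) (exact_colonMul_factorLinear hJ hIJ) hψ
  exact_succ := by
    rintro (_ | i)
    · exact cone_exact_one (hF.exact_succ 0) hF.exact_zero hG.exact_zero
        (colonMul I (MvPolynomial.monomial u 1)) (colonMul_injective I _) hψ (ψ.comm 0)
    · exact cone_exact_succ (hF.exact_succ (i + 1)) (hG.exact_succ i) (ψ.comm (i + 1))

theorem cone_isMinimal {F G : GradedFreeComplex σ k} {e : ℤ} (hF : F.IsMinimal)
    (hG : G.IsMinimal) (ψ : Hom (G.shift e) F)
    (hψ : ∀ i a b, ψ.f i a b ∈ MvPolynomial.idealOfVars σ k) : (cone ψ).IsMinimal := by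
  rintro (_ | i)
  · rintro a (b | b)
    · exact hF 0 a b
    · exact hψ 0 a b
  · rintro (a | a) (b | b)
    · exact hF (i + 1) a b
    · exact hψ (i + 1) a b
    · exact Ideal.zero_mem _
    · exact neg_mem (hG i a b)

/-- If some variable has larger degree in `u` than in the generators of `I`, then every lift of
the multiplication by `u` between minimal resolutions has entries in the maximal ideal. -/
theorem lift_colonMul_mem {l : List (σ →₀ ℕ)} {u : σ →₀ ℕ} {x : σ}
    (hxu : u x ≠ 0) (hx : ∀ a ∈ l, a x < u x)
    {F G : GradedFreeComplex σ k} {ε : F.ι 0 → MvPolynomial σ k ⧸ monomialIdeal k l}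
    (hF : IsMinimalResolution (quotientGrading (monomialIdeal k l)) F ε)
    {η : G.ι 0 → MvPolynomial σ k ⧸ (monomialIdeal k l).colon {MvPolynomial.monomial u (1 : k)}}
    (hG : IsMinimalResolution
      (quotientGrading ((monomialIdeal k l).colon {MvPolynomial.monomial u (1 : k)})) G η)
    (f : ∀ i, Matrix (F.ι i) (G.ι i) (MvPolynomial σ k))
    (hf : ∀ b, Fintype.linearCombination (MvPolynomial σ k) ε (fun a => f 0 a b) =
        colonMul (monomialIdeal k l) (MvPolynomial.monomial u 1) (η b))
    (hc : ∀ i, f i * G.d i = F.d i * f (i + 1)) (i : ℕ) (a : F.ι i) (b : G.ι i) :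
    f i a b ∈ MvPolynomial.idealOfVars σ k := by
  classical
  -- Multiplication by `u/x`, made to start from `R/(I : u)` through the inclusion of the colon
  -- ideals.
  let g := (colonMul (monomialIdeal k l)
      (MvPolynomial.monomial (u - Finsupp.single x 1) (1 : k))).comp
    (factorLinear (colon_monomialIdeal_le (k := k) hx))
  have hg : ∀ y, (MvPolynomial.X x : MvPolynomial σ k) • g y =
      colonMul (monomialIdeal k l) (MvPolynomial.monomial u 1) y := by
    intro y
    obtain ⟨p, rfl⟩ := Ideal.Quotient.mk_surjective y
    have h1 : (MvPolynomial.monomial u (1 : k)) =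
        MvPolynomial.X x * MvPolynomial.monomial (u - Finsupp.single x 1) 1 := by
      rw [MvPolynomial.X, MvPolynomial.monomial_mul, one_mul,
        add_tsub_cancel_of_le (by
          rw [Finsupp.single_le_iff]; omega)]
    change Ideal.Quotient.mk (monomialIdeal k l) (MvPolynomial.X x *
      (p * MvPolynomial.monomial (u - Finsupp.single x 1) (1 : k))) =
      Ideal.Quotient.mk (monomialIdeal k l) (p * MvPolynomial.monomial u 1)
    rw [h1]
    congr 1
    ring
  obtain ⟨f', hf', hc'⟩ := exists_lift hF.1.isFreeResolution hG.1.isFreeResolution g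
  have h := sub_mem_of_lifts (MvPolynomial.idealOfVars σ k) hF.1.isFreeResolution
    hG.1.isFreeResolution hF.2 hG.2 f (fun i => (MvPolynomial.X x : MvPolynomial σ k) • f' i)
    (fun b => by
      rw [hf, ← hg, ← hf', ← map_smul]
      rfl)
    hc (fun i => by rw [Matrix.smul_mul, hc', Matrix.mul_smul]) i a b
  have h2 : ((MvPolynomial.X x : MvPolynomial σ k) • f' i) a b ∈ MvPolynomial.idealOfVars σ k :=
    Ideal.mul_mem_right _ _ (Ideal.subset_span ⟨x, rfl⟩)
  simpa using add_mem h h2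

end GradedFreeComplex

open GradedFreeComplex

/-- Each monomial of the list is divisible by a variable dividing no other one. -/
def HasPrivateVars (l : List (σ →₀ ℕ)) : Prop :=
  l.Nodup ∧ ∀ a ∈ l, ∃ x, a x ≠ 0 ∧ ∀ b ∈ l, b ≠ a → b x = 0

theorem HasPrivateVars.of_append {l : List (σ →₀ ℕ)} {u : σ →₀ ℕ} (h : HasPrivateVars (l ++ [u])) :
    HasPrivateVars l :=
  ⟨h.1.of_append_left, fun a ha => by
    obtain ⟨x, hx, hb⟩ := h.2 a (List.mem_append_left _ ha)
    exact ⟨x, hx, fun b hb' => hb b (List.mem_append_left _ hb')⟩⟩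

theorem HasPrivateVars.last {l : List (σ →₀ ℕ)} {u : σ →₀ ℕ} (h : HasPrivateVars (l ++ [u])) :
    ∃ x, u x ≠ 0 ∧ ∀ a ∈ l, a x = 0 := by
  obtain ⟨x, hx, hb⟩ := h.2 u (by simp)
  refine ⟨x, hx, fun a ha => hb a (List.mem_append_left _ ha) ?_⟩
  rintro rfl
  exact (List.nodup_append.1 h.1).2.2 a ha a (by simp) rfl

/-- The private variable of `a` does not divide `u`, so subtracting `u` leaves its exponent
unchanged. It also keeps the entries of the new list distinct. -/
theorem HasPrivateVars.map_tsub {l : List (σ →₀ ℕ)} {u : σ →₀ ℕ} (h : HasPrivateVars (l ++ [u])) :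
    HasPrivateVars (l.map (· - u)) := by
  have key : ∀ a ∈ l, ∃ x, (a - u) x ≠ 0 ∧ ∀ b ∈ l, b ≠ a → (b - u) x = 0 := by
    intro a ha
    obtain ⟨x, hx, hb⟩ := h.2 a (List.mem_append_left _ ha)
    have hu : u x = 0 := hb u (by simp) (by
      rintro rfl
      exact (List.nodup_append.1 h.1).2.2 u ha u (by simp) rfl)
    refine ⟨x, by simpa [hu] using hx, fun b hb' hne => ?_⟩
    simp [hb b (List.mem_append_left _ hb') hne]
  refine ⟨h.of_append.1.map_on fun a ha b hb hab => ?_, ?_⟩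
  · by_contra hne
    obtain ⟨x, hx, hx'⟩ := key a ha
    have hab' : a - u = b - u := hab
    rw [hab'] at hx
    exact hx (hx' b hb fun h => hne h.symm)
  · intro a' ha'
    obtain ⟨a, ha, rfl⟩ := List.mem_map.1 ha'
    obtain ⟨x, hx, hx'⟩ := key a ha
    refine ⟨x, hx, fun b' hb' hne => ?_⟩
    obtain ⟨b, hb, rfl⟩ := List.mem_map.1 hb'
    exact hx' b hb fun hab => hne (by rw [hab])

theorem IsIteratedMappingCone.eq_and_isMinimalResolution {l : List (σ →₀ ℕ)}
    {I : Ideal (MvPolynomial σ k)} {C : GradedFreeComplex σ k} {ε : C.ι 0 → MvPolynomial σ k ⧸ I}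
    (h : IsIteratedMappingCone l I C ε) (hl : HasPrivateVars l) :
    I = monomialIdeal k l ∧ IsMinimalResolution (quotientGrading I) C ε := by
  induction h with
  | nil F ε hF => exact ⟨monomialIdeal_nil.symm, hF⟩
  | snoc l u I J hJ F ε hF G η hG ψ hψ ih =>
    obtain ⟨rfl, hFm⟩ := ih hl.of_append
    obtain ⟨x, hxu, hx⟩ := hl.last
    refine ⟨hJ.trans (monomialIdeal_append_singleton l u).symm,
      cone_isResolution hJ _ hFm.1 hG.1 ψ hψ, cone_isMinimal hFm.2 hG.2 ψ ?_⟩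
    exact lift_colonMul_mem hxu (fun a ha => by rw [hx a ha]; omega) hFm hG ψ.f hψ ψ.comm

/-- The exponent vector of the least common multiple of a list of monomials. -/
def lcmList (l : List (σ →₀ ℕ)) : σ →₀ ℕ := l.foldr (· ⊔ ·) 0

theorem lcmList_append_singleton (l : List (σ →₀ ℕ)) (u : σ →₀ ℕ) :
    lcmList (l ++ [u]) = lcmList l ⊔ u := by
  induction l with
  | nil => simp [lcmList]
  | cons a l ih =>
    change a ⊔ lcmList (l ++ [u]) = (a ⊔ lcmList l) ⊔ u
    rw [ih, sup_assoc]

/-- Coordinatewise, `max (a - u) + u = max a u`. Thus the shift by `u` moves the top degree of the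
resolution of the colon ideal to that of the cone. -/
theorem lcmList_map_tsub_add (l : List (σ →₀ ℕ)) (u : σ →₀ ℕ) :
    lcmList (l.map (· - u)) + u = lcmList (l ++ [u]) := by
  rw [lcmList_append_singleton]
  induction l with
  | nil => simp [lcmList]
  | cons a l ih =>
    change ((a - u) ⊔ lcmList (l.map (· - u))) + u = (a ⊔ lcmList l) ⊔ u
    ext x
    have := DFunLike.congr_fun ih x
    simp only [Finsupp.add_apply, Finsupp.sup_apply, Finsupp.tsub_apply] at this ⊢
    omega

theorem lcmList_apply_eq_zero {l : List (σ →₀ ℕ)} {x : σ} (h : ∀ a ∈ l, a x = 0) :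
    lcmList l x = 0 := by
  induction l with
  | nil => rfl
  | cons a l ih =>
    change (a ⊔ lcmList l) x = 0
    rw [Finsupp.sup_apply, ih fun b hb => h b (List.mem_cons_of_mem _ hb),
      h a List.mem_cons_self]
    rfl

theorem le_lcmList {l : List (σ →₀ ℕ)} {a : σ →₀ ℕ} (h : a ∈ l) : a ≤ lcmList l := by
  induction l with
  | nil => simp at h
  | cons b l ih =>
    change a ≤ b ⊔ lcmList l
    rcases List.mem_cons.1 h with rfl | h
    · exact le_sup_left
    · exact (ih h).trans le_sup_right

/-- The private variable of `u` is new in the lcm. This increase by at least one compensates for the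
additional generator in the regularity bound on the summand `F` of the cone. -/
theorem degree_lcmList_lt {l : List (σ →₀ ℕ)} {u : σ →₀ ℕ} (h : HasPrivateVars (l ++ [u])) :
    (lcmList l).degree < (lcmList (l ++ [u])).degree := by
  classical
  obtain ⟨x, hxu, hx⟩ := h.last
  have h1 : lcmList l + Finsupp.single x 1 ≤ lcmList (l ++ [u]) := by
    rw [lcmList_append_singleton]
    intro y
    simp only [Finsupp.add_apply, Finsupp.sup_apply, Finsupp.single_apply]
    split_ifs with hxy
    · subst hxy
      rw [lcmList_apply_eq_zero hx]
      simp only [zero_add, zero_le, sup_of_le_right]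
      omega
    · simp
  have h2 := Finsupp.degree_mono h1
  rw [map_add, Finsupp.degree_single] at h2
  omega

/-- The resolution `R → R` of `R ⧸ 0`. -/
def trivialComplex (σ k : Type*) [Field k] : GradedFreeComplex σ k where
  ι := fun | 0 => Unit | _ + 1 => Empty
  fin := fun | 0 => inferInstanceAs (Fintype Unit) | _ + 1 => inferInstanceAs (Fintype Empty)
  deg _ _ := 0
  d _ _ b := Empty.elim b
  d_homog _ _ b := Empty.elim b
  d_comp_d _ := Matrix.ext fun _ b => Empty.elim b

theorem trivialComplex_isMinimalResolution :
    IsMinimalResolution (quotientGrading (⊥ : Ideal (MvPolynomial σ k))) (trivialComplex σ k)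
      (fun _ => 1) := by
  have hlc : ∀ x : (trivialComplex σ k).ι 0 → MvPolynomial σ k,
      Fintype.linearCombination (MvPolynomial σ k)
        (fun _ => (1 : MvPolynomial σ k ⧸ (⊥ : Ideal (MvPolynomial σ k)))) x =
      Ideal.Quotient.mk _ (x ()) := by
    intro x
    rw [Fintype.linearCombination_apply]
    refine (Fintype.sum_unique (ι := Unit) _).trans ?_
    exact congrArg _ (mul_one (x ()))
  refine ⟨⟨fun a => ⟨1, MvPolynomial.isHomogeneous_one σ k, rfl⟩, fun y => ?_, fun v => ?_,
    fun i v => ?_⟩, fun i a b => Empty.elim b⟩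
  · obtain ⟨p, rfl⟩ := Ideal.Quotient.mk_surjective y
    exact ⟨fun _ => p, hlc _⟩
  · rw [hlc, Ideal.Quotient.eq_zero_iff_mem, Ideal.mem_bot]
    constructor
    · intro h
      refine ⟨0, ?_⟩
      rw [map_zero]
      ext a : 1
      exact h.symm
    · rintro ⟨w, rfl⟩
      rw [show w = 0 from funext fun b => Empty.elim b, map_zero]
      rfl
  · have : ∀ w w' : (trivialComplex σ k).ι (i + 1) → MvPolynomial σ k, w = w' :=
      fun w w' => funext fun b => Empty.elim b
    constructor
    · intro _
      exact ⟨0, this _ _⟩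
    · rintro ⟨w, rfl⟩
      rw [this ((Matrix.mulVecLin _) w) 0, map_zero]

/-- The induction is applied to `l` and to the colon list, both one shorter. The degree bound is
attained in homological degree `m`, on the summand coming from the colon ideal. -/
theorem exists_isIteratedMappingCone (m : ℕ) (l : List (σ →₀ ℕ)) (hm : l.length = m)
    (hl : HasPrivateVars l) :
    ∃ (C : GradedFreeComplex σ k) (ε : C.ι 0 → MvPolynomial σ k ⧸ monomialIdeal k l),
      IsIteratedMappingCone l (monomialIdeal k l) C ε ∧
      (∀ i, Fintype.card (C.ι i) = m.choose i) ∧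
      (∀ i a, C.deg i a - i ≤ (lcmList l).degree - m) ∧
      ∃ a, C.deg m a = (lcmList l).degree := by
  induction m generalizing l with
  | zero =>
    obtain rfl := List.length_eq_zero_iff.1 hm
    rw [monomialIdeal_nil]
    refine ⟨trivialComplex σ k, fun _ => 1, .nil _ _ trivialComplex_isMinimalResolution, ?_, ?_,
      ⟨(), by simp [lcmList, trivialComplex]⟩⟩
    · rintro (_ | i)
      · exact Fintype.card_unit
      · exact Fintype.card_empty
    · rintro (_ | i) a
      · simp [lcmList, trivialComplex]
      · exact Empty.elim a
  | succ m ih =>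
    obtain ⟨l, u, rfl⟩ : ∃ l' u, l = l' ++ [u] :=
      ⟨l.dropLast, l.getLast (by rintro rfl; simp at hm), (List.dropLast_append_getLast _).symm⟩
    have hm' : l.length = m := by simpa using hm
    obtain ⟨F, ε, hF, hFc, hFr, a₀, ha₀⟩ := ih l hm' hl.of_append
    obtain ⟨G, η, hG, hGc, hGr, b₀, hb₀⟩ := ih (l.map (· - u)) (by simpa using hm') hl.map_tsub
    have hF' := (hF.eq_and_isMinimalResolution hl.of_append).2
    have hG' := (hG.eq_and_isMinimalResolution hl.map_tsub).2
    -- The type of `η` mentions the ideal, so rewriting it as a colon ideal requires generalizing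
    -- `η`. Of `G` only the minimal resolution property is still needed.
    clear hG
    revert η
    rw [← colon_monomialIdeal]
    intro η hG'
    obtain ⟨f, hfh, hfc, hf⟩ := exists_graded_lift (homogClosed_monomialIdeal l) hG'.1 hF'.1
      (colonMul _ (MvPolynomial.monomial u 1)) u.degree (by
        intro b
        obtain ⟨p, hp, hp'⟩ := exists_homogeneous_rep (hG'.1.aug_mem b)
        rw [← hp', colonMul_mk]
        refine ⟨p * MvPolynomial.monomial u 1, ?_, rfl⟩
        have h1 : (MvPolynomial.monomial u (1 : k)) ∈ homogPart σ k (u.degree : ℤ) :=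
          MvPolynomial.isHomogeneous_monomial _ rfl
        have h2 := homogComp_mul_of_left_mem hp (MvPolynomial.monomial u 1)
          (G.deg 0 b + u.degree)
        rw [add_sub_cancel_left, homogComp_of_mem h1] at h2
        rw [← h2]
        exact homogComp_mem _ _)
    let ψ : Hom (G.shift (u.degree : ℤ)) F := ⟨f, hfh, hfc⟩
    have hdeg : (lcmList (l ++ [u])).degree = (lcmList (l.map (· - u))).degree + u.degree := by
      rw [← lcmList_map_tsub_add, map_add]
    have hlt := degree_lcmList_lt hl
    refine ⟨cone ψ, _, .snoc l u _ _ (monomialIdeal_append_singleton l u) F ε hF G η hG' ψ hf,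
      ?_, ?_, ?_⟩
    · rintro (_ | i)
      · exact (hFc 0).trans (by simp)
      · refine (Fintype.card_sum (α := F.ι (i + 1)) (β := G.ι i)).trans ?_
        rw [hFc, hGc, Nat.choose_succ_succ, add_comm]
    · rintro (_ | i) a
      · have := hFr 0 a
        change F.deg 0 a - _ ≤ _
        push_cast at this ⊢
        omega
      · rcases a with a | a
        · have := hFr (i + 1) a
          change F.deg (i + 1) a - _ ≤ _
          push_cast at this ⊢
          omega
        · have := hGr i a
          change G.deg i a + (u.degree : ℤ) - _ ≤ _
          rw [hdeg]
          push_cast at this ⊢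
          omega
    · refine ⟨Sum.inr b₀, ?_⟩
      change G.deg m b₀ + (u.degree : ℤ) = _
      rw [hb₀, hdeg]
      push_cast
      rfl

end Monomial
end MaxPath
end

/-! ### Depth and the length of minimal resolutions. -/

noncomputable section
namespace MaxPath

open RingTheory.Sequence

section Depth

open scoped Pointwise

variable {R : Type*} [CommRing R]

/-- The map `N^b → N^a` defined by an `a × b` matrix over `R`. -/
def matrixAct {a b : Type*} [Fintype b] (A : Matrix a b R) (N : Type*) [AddCommGroup N]
    [Module R N] : (b → N) →ₗ[R] (a → N) where
  toFun v i := ∑ j, A i j • v j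
  map_add' v w := by ext i; simp [Finset.sum_add_distrib]
  map_smul' r v := by
    ext i
    simp only [Pi.smul_apply, Finset.smul_sum, RingHom.id_apply]
    exact Finset.sum_congr rfl fun j _ => smul_comm _ _ _

theorem matrixAct_self {a b : Type*} [Fintype b] (A : Matrix a b R) :
    matrixAct A R = A.mulVecLin := by
  ext v i
  rfl

theorem matrixAct_apply {a b : Type*} [Fintype b] (A : Matrix a b R) {N : Type*} [AddCommGroup N]
    [Module R N] (v : b → N) (i : a) : matrixAct A N v i = ∑ j, A i j • v j := rfl

theorem matrixAct_map {a b : Type*} [Fintype b] (A : Matrix a b R) {N N' : Type*} [AddCommGroup N]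
    [Module R N] [AddCommGroup N'] [Module R N'] (g : N →ₗ[R] N') (v : b → N) :
    matrixAct A N' (fun j => g (v j)) = fun i => g (matrixAct A N v i) := by
  ext i
  simp [matrixAct_apply]

theorem mkQ_quotSMulTop_eq_zero_iff {N : Type*} [AddCommGroup N] [Module R N] {r : R} {x : N} :
    (r • (⊤ : Submodule R N)).mkQ x = 0 ↔ ∃ y, r • y = x := by
  rw [Submodule.mkQ_apply, Submodule.Quotient.mk_eq_zero, Submodule.mem_smul_pointwise_iff_exists]
  simp

theorem exists_lift_quotSMulTop {N : Type*} [AddCommGroup N] [Module R N] {a : Type*} (r : R)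
    (v : a → QuotSMulTop r N) :
    ∃ w : a → N, v = fun i => (r • (⊤ : Submodule R N)).mkQ (w i) := by
  choose w hw using fun i => Submodule.mkQ_surjective (r • (⊤ : Submodule R N)) (v i)
  exact ⟨w, funext fun i => (hw i).symm⟩

section Chase

variable {ι : ℕ → Type*} [∀ i, Fintype (ι i)] (d : ∀ i, Matrix (ι i) (ι (i + 1)) R)

/-- The complex obtained by tensoring with `N` is exact in homological degrees above `t`. -/
def ExactAbove (N : Type*) [AddCommGroup N] [Module R N] (t : ℕ) : Prop :=
  ∀ j, t ≤ j → Function.Exact (matrixAct (d (j + 1)) N) (matrixAct (d j) N)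

variable {d}

/-- The long exact homology sequence of `0 → N → N → N/rN → 0`, chased by hand: vanishing of
homology in degrees above `t` becomes vanishing above `t + 1`. -/
theorem ExactAbove.quotSMulTop {N : Type*} [AddCommGroup N] [Module R N] {t : ℕ}
    (h : ExactAbove d N t) {r : R} (hr : IsSMulRegular N r) :
    ExactAbove d (QuotSMulTop r N) (t + 1) := by
  intro j hj v
  obtain ⟨j, rfl⟩ : ∃ i, j = i + 1 := ⟨j - 1, by omega⟩
  constructor
  · intro hv
    obtain ⟨w, rfl⟩ := exists_lift_quotSMulTop r v
    rw [matrixAct_map] at hv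
    choose y hy using fun i => mkQ_quotSMulTop_eq_zero_iff.1 (congrFun hv i)
    have hy' : r • y = matrixAct (d (j + 1)) N w := funext hy
    have h1 : matrixAct (d j) N y = 0 := by
      have h2 := (h j (by omega)).apply_apply_eq_zero w
      rw [← hy', map_smul] at h2
      exact funext fun i => hr (by simpa using congrFun h2 i)
    obtain ⟨z, hz⟩ := (h j (by omega) _).1 h1
    obtain ⟨x, hx⟩ := (h (j + 1) (by omega) (w - r • z)).1 (by
      rw [map_sub, map_smul, hz, hy', sub_self])
    refine ⟨fun i => (r • (⊤ : Submodule R N)).mkQ (x i), ?_⟩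
    rw [matrixAct_map, hx]
    ext i
    rw [Pi.sub_apply, map_sub, sub_eq_self]
    exact mkQ_quotSMulTop_eq_zero_iff.2 ⟨z i, rfl⟩
  · rintro ⟨y, rfl⟩
    obtain ⟨w, rfl⟩ := exists_lift_quotSMulTop r y
    rw [matrixAct_map, matrixAct_map, (h (j + 1) (by omega)).apply_apply_eq_zero]
    ext i
    simp

theorem ofList_cons_smul_mkQ {N : Type*} [AddCommGroup N] [Module R N] {r : R} {rs : List R}
    {x : N} (hx : x ∈ Ideal.ofList (r :: rs) • (⊤ : Submodule R N)) :
    (r • (⊤ : Submodule R N)).mkQ x ∈ Ideal.ofList rs • (⊤ : Submodule R (QuotSMulTop r N)) := by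
  rw [Ideal.ofList_cons_smul] at hx
  obtain ⟨y, hy, z, hz, rfl⟩ := Submodule.mem_sup.1 hx
  rw [map_add, Submodule.mkQ_apply _ y, (Submodule.Quotient.mk_eq_zero _).2 hy, zero_add]
  have := Submodule.mem_map_of_mem (f := (r • (⊤ : Submodule R N)).mkQ) hz
  rw [Submodule.map_smul''] at this
  exact Submodule.smul_mono le_rfl le_top this

/-- Dividing by the whole sequence leaves a nonzero module killed by all matrix entries. The
differentials then vanish, so exactness forces the terms above `t + rs.length` to have empty bases.
-/
theorem isEmpty_of_isRegular (rs : List R) (N : Type*) [AddCommGroup N] [Module R N] (t : ℕ)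
    (hrs : IsRegular N rs) (hd : ExactAbove d N t)
    (hmem : ∀ i a b (y : N), d i a b • y ∈ Ideal.ofList rs • (⊤ : Submodule R N)) (s : ℕ)
    (hs : t + rs.length < s) : IsEmpty (ι s) := by
  classical
  induction rs generalizing N t with
  | nil =>
    have := hrs.nontrivial
    obtain ⟨y, hy⟩ := exists_ne (0 : N)
    have hz : ∀ i (v : ι (i + 1) → N), matrixAct (d i) N v = 0 := by
      intro i v
      ext a
      refine Finset.sum_eq_zero fun b _ => ?_
      simpa using hmem i a b (v b)
    obtain ⟨s, rfl⟩ : ∃ i, s = i + 1 := ⟨s - 1, by omega⟩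
    refine ⟨fun a => ?_⟩
    obtain ⟨w, hw⟩ := (hd s (by simp at hs; omega) (Pi.single a y)).1 (hz _ _)
    rw [hz] at hw
    exact hy (by simpa using (congrFun hw a).symm)
  | cons r rs ih =>
    rw [isRegular_cons_iff] at hrs
    refine ih (QuotSMulTop r N) (t + 1) hrs.2 (hd.quotSMulTop hrs.1) ?_
      (by simp at hs; omega)
    intro i a b y
    obtain ⟨y, rfl⟩ := Submodule.mkQ_surjective _ y
    rw [← map_smul]
    exact ofList_cons_smul_mkQ (hmem i a b y)

/-- The class of `z` in the cokernel is nonzero and killed by `rs`. If `w` maps to `r • z`, then `w`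
gives such a class over `N/rN` one degree higher: this is the connecting homomorphism. After all of
`rs`, a nonzero class lives in degree `t + rs.length`. -/
theorem nonempty_of_socle (rs : List R) (N : Type*) [AddCommGroup N] [Module R N] (t : ℕ)
    (hrs : IsWeaklyRegular N rs) (hd : ExactAbove d N t) (z : ι t → N)
    (hz : z ∉ LinearMap.range (matrixAct (d t) N))
    (hrz : ∀ r ∈ rs, r • z ∈ LinearMap.range (matrixAct (d t) N)) :
    Nonempty (ι (t + rs.length)) := by
  induction rs generalizing N t with
  | nil =>
    by_contra hne
    rw [not_nonempty_iff] at hne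
    exact hz ⟨0, (map_zero _).trans (funext fun a => (IsEmpty.false (α := ι t) a).elim)⟩
  | cons r rs ih =>
    rw [isWeaklyRegular_cons_iff] at hrs
    obtain ⟨w, hw⟩ := hrz r List.mem_cons_self
    have h := ih (QuotSMulTop r N) (t + 1) hrs.2 (hd.quotSMulTop hrs.1)
      (fun i => (r • (⊤ : Submodule R N)).mkQ (w i)) ?_ ?_
    · rwa [List.length_cons, add_comm rs.length, ← add_assoc]
    · rintro ⟨v, hv⟩
      obtain ⟨v, rfl⟩ := exists_lift_quotSMulTop r v
      rw [matrixAct_map] at hv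
      have h1 : ∀ i, (r • (⊤ : Submodule R N)).mkQ ((w - matrixAct (d (t + 1)) N v) i) = 0 :=
        fun i => by
          rw [Pi.sub_apply, map_sub, sub_eq_zero]
          exact (congrFun hv i).symm
      choose y hy using fun i => mkQ_quotSMulTop_eq_zero_iff.1 (h1 i)
      have hy' : r • y = w - matrixAct (d (t + 1)) N v := funext hy
      have h2 : r • matrixAct (d t) N y = r • z := by
        rw [← map_smul, hy', map_sub, hw, (hd t le_rfl).apply_apply_eq_zero, sub_zero]
      exact hz ⟨y, funext fun i => hrs.1 (congrFun h2 i)⟩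
    · intro s hs
      obtain ⟨y, hy⟩ := hrz s (List.mem_cons_of_mem _ hs)
      obtain ⟨v, hv⟩ := (hd t le_rfl (s • w - r • y)).1 (by
        rw [map_sub, map_smul, map_smul, hw, hy, smul_comm, sub_self])
      refine ⟨fun i => (r • (⊤ : Submodule R N)).mkQ (v i), ?_⟩
      rw [matrixAct_map, hv]
      ext i
      rw [Pi.sub_apply, map_sub, Pi.smul_apply, Pi.smul_apply, map_smul, Pi.smul_apply,
        sub_eq_self]
      exact mkQ_quotSMulTop_eq_zero_iff.2 ⟨y i, rfl⟩

end Chase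

/-- `M` has a free resolution of length exactly `p` by nonzero modules, whose differentials have
entries in `𝔪`. -/
def HasMinimalResolution (𝔪 : Ideal R) (M : Type*) [AddCommGroup M] [Module R M] (p : ℕ) : Prop :=
  ∃ (ι : ℕ → Type) (_ : ∀ i, Fintype (ι i)) (d : ∀ i, Matrix (ι i) (ι (i + 1)) R) (ε : ι 0 → M),
    IsFreeResolution d ε ∧ (∀ i a b, d i a b ∈ 𝔪) ∧ Nonempty (ι p) ∧ ∀ i, p < i → IsEmpty (ι i)

/-- Index types of the cone of an endomorphism. -/
def EndConeIdx (ι : ℕ → Type) : ℕ → Type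
  | 0 => ι 0
  | i + 1 => ι (i + 1) ⊕ ι i

instance endConeFintype (ι : ℕ → Type) [h : ∀ i, Fintype (ι i)] : ∀ i, Fintype (EndConeIdx ι i)
  | 0 => h 0
  | i + 1 => inferInstanceAs (Fintype (ι (i + 1) ⊕ ι i))

/-- The cone of the multiplication by `r`. -/
def endConeD {ι : ℕ → Type} [∀ i, DecidableEq (ι i)] (d : ∀ i, Matrix (ι i) (ι (i + 1)) R) (r : R) :
    ∀ i, Matrix (EndConeIdx ι i) (EndConeIdx ι (i + 1)) R
  | 0 => Matrix.fromCols (d 0) (r • (1 : Matrix (ι 0) (ι 0) R))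
  | i + 1 => Matrix.fromBlocks (d (i + 1)) (r • (1 : Matrix (ι (i + 1)) (ι (i + 1)) R)) 0 (-(d i))

/-- Regularity of `r` is injectivity of multiplication by `r` on `M`, so the cone of multiplication
by `r` resolves `M/rM`. -/
theorem IsFreeResolution.endCone {ι : ℕ → Type} [∀ i, Fintype (ι i)] [∀ i, DecidableEq (ι i)]
    {d : ∀ i, Matrix (ι i) (ι (i + 1)) R} {M : Type*} [AddCommGroup M] [Module R M] {ε : ι 0 → M}
    (h : IsFreeResolution d ε) {r : R} (hr : IsSMulRegular M r) :
    IsFreeResolution (endConeD d r) (fun a => (r • (⊤ : Submodule R M)).mkQ (ε a)) := by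
  have hf : ∀ b, Fintype.linearCombination R ε (fun a => (r • (1 : Matrix (ι 0) (ι 0) R)) a b) =
      LinearMap.lsmul R M r (ε b) := by
    intro b
    have h2 : (fun a => (r • (1 : Matrix (ι 0) (ι 0) R)) a b) = r • Pi.single b 1 := by
      ext a; rw [Matrix.smul_apply, Matrix.one_apply, Pi.smul_apply, Pi.single_apply]
    rw [h2, map_smul, Fintype.linearCombination_apply_single, one_smul]
    rfl
  have hc : ∀ i, (r • (1 : Matrix (ι i) (ι i) R)) * d i =
      d i * (r • (1 : Matrix (ι (i + 1)) (ι (i + 1)) R)) := by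
    intro i
    rw [Matrix.smul_mul, Matrix.one_mul, Matrix.mul_smul, Matrix.mul_one]
  refine ⟨fun y => ?_, ?_, ?_⟩
  · obtain ⟨x, rfl⟩ := Submodule.mkQ_surjective _ y
    obtain ⟨z, rfl⟩ := h.aug_surjective x
    exact ⟨z, linearCombination_map ε _ z⟩
  · have hex : Function.Exact (LinearMap.lsmul R M r) (r • (⊤ : Submodule R M)).mkQ :=
      fun x => mkQ_quotSMulTop_eq_zero_iff
    exact cone_exact_zero h.exact_zero h.aug_surjective (LinearMap.lsmul R M r)
      (r • (⊤ : Submodule R M)).mkQ hex hf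
  · rintro (_ | i)
    · exact cone_exact_one (h.exact_succ 0) h.exact_zero h.exact_zero
        (LinearMap.lsmul R M r) hr hf (hc 0)
    · exact cone_exact_succ (h.exact_succ (i + 1)) (h.exact_succ i) (hc (i + 1))

theorem HasMinimalResolution.quotSMulTop {𝔪 : Ideal R} {M : Type*} [AddCommGroup M] [Module R M]
    {p : ℕ} (h : HasMinimalResolution 𝔪 M p) {r : R} (hr : IsSMulRegular M r) (hrm : r ∈ 𝔪) :
    HasMinimalResolution 𝔪 (QuotSMulTop r M) (p + 1) := by
  classical
  obtain ⟨ι, _, d, ε, hd, hm, ⟨a⟩, he⟩ := h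
  refine ⟨EndConeIdx ι, inferInstance, endConeD d r, _, hd.endCone hr, ?_, ⟨Sum.inr a⟩, ?_⟩
  · rintro (_ | i)
    · rintro a (b | b)
      · exact hm 0 a b
      · exact Ideal.mul_mem_right _ _ hrm
    · rintro (a | a) (b | b)
      · exact hm (i + 1) a b
      · exact Ideal.mul_mem_right _ _ hrm
      · exact Ideal.zero_mem _
      · exact neg_mem (hm i a b)
  · rintro (_ | i) hi
    · omega
    · have := he (i + 1) (by omega)
      have := he i (by omega)
      exact inferInstanceAs (IsEmpty (ι (i + 1) ⊕ ι i))

theorem IsFreeResolution.exactAbove {ι : ℕ → Type*} [∀ i, Fintype (ι i)]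
    {d : ∀ i, Matrix (ι i) (ι (i + 1)) R} {M : Type*} [AddCommGroup M] [Module R M] {ε : ι 0 → M}
    (h : IsFreeResolution d ε) : ExactAbove d R 0 := fun j _ => by
  rw [matrixAct_self, matrixAct_self]
  exact h.exact_succ j

theorem HasMinimalResolution.le_length {𝔪 : Ideal R} {M : Type*} [AddCommGroup M] [Module R M]
    {p : ℕ} (h : HasMinimalResolution 𝔪 M p) {xs : List R} (hxs : IsRegular R xs)
    (hm : Ideal.ofList xs = 𝔪) : p ≤ xs.length := by
  obtain ⟨ι, _, d, ε, hd, hdm, hp, -⟩ := h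
  by_contra hlt
  rw [not_le] at hlt
  refine not_isEmpty_iff.2 hp (isEmpty_of_isRegular xs R 0 hxs hd.exactAbove (fun i a b y => ?_) p
    (by omega))
  rw [hm]
  exact Submodule.smul_mem_smul (hdm i a b) trivial

/-- Otherwise prime avoidance makes `𝔪` an associated prime, the annihilator of some `ξ`. A lift of
`ξ` to the zeroth free module is a socle class, which forces a nonzero term in degree `xs.length >
p`. -/
theorem HasMinimalResolution.exists_regular [IsNoetherianRing R] {𝔪 : Ideal R} [𝔪.IsMaximal]
    {M : Type*} [AddCommGroup M] [Module R M] {p : ℕ} (h : HasMinimalResolution 𝔪 M p)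
    {xs : List R} (hxs : IsRegular R xs) (hm : Ideal.ofList xs = 𝔪) (hp : p < xs.length) :
    ∃ r ∈ 𝔪, IsSMulRegular M r := by
  obtain ⟨ι, _, d, ε, hd, -, -, he⟩ := h
  have : Module.Finite R M := Module.Finite.of_surjective _ hd.aug_surjective
  by_contra! hreg
  have hsub : (𝔪 : Set R) ⊆ ⋃ q ∈ associatedPrimes R M, (q : Set R) := by
    rw [biUnion_associatedPrimes_eq_compl_regular]
    exact fun r hr => hreg r hr
  obtain ⟨q, hq, hle⟩ := (𝔪.subset_union_prime_finite (associatedPrimes.finite R M) (f := id)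
    0 0 fun _ h _ _ => h.1).1 hsub
  have hq' : IsAssociatedPrime q M := hq
  obtain rfl : 𝔪 = q := Ideal.IsMaximal.eq_of_le inferInstance hq'.1.ne_top hle
  obtain ⟨-, ξ, hξ⟩ := (isAssociatedPrime_iff).1 hq'
  have hξr : ∀ r, r ∈ 𝔪 ↔ r • ξ = 0 := fun r => by
    conv_lhs => rw [hξ]
    rw [Submodule.mem_colon_singleton, Submodule.mem_bot]
  obtain ⟨z, hz⟩ := hd.aug_surjective ξ
  have hrange : ∀ y, y ∈ LinearMap.range (matrixAct (d 0) R) ↔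
      Fintype.linearCombination R ε y = 0 := fun y => by
    rw [matrixAct_self]
    exact (hd.exact_zero y).symm
  have h := nonempty_of_socle xs R 0 hxs.toIsWeaklyRegular hd.exactAbove z
    (fun hzr => by
      rw [hrange, hz] at hzr
      refine (Ideal.ne_top_iff_one 𝔪).1 Ideal.IsPrime.ne_top' ((hξr 1).2 ?_)
      rw [hzr, smul_zero])
    (fun r hr => by
      rw [hrange, map_smul, hz, ← hξr, ← hm]
      exact Ideal.subset_span hr)
  rw [zero_add] at h
  exact not_isEmpty_iff.2 h (he _ hp)

/-- Each regular element raises the length of the minimal resolution by one, and that length never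
exceeds `xs.length`. -/
theorem HasMinimalResolution.add_length_le {𝔪 : Ideal R} {xs : List R} (hxs : IsRegular R xs)
    (hm : Ideal.ofList xs = 𝔪) (rs : List R) (M : Type*) [AddCommGroup M] [Module R M] (p : ℕ)
    (h : HasMinimalResolution 𝔪 M p) (hrs : IsRegular M rs) (hrm : ∀ r ∈ rs, r ∈ 𝔪) :
    p + rs.length ≤ xs.length := by
  induction rs generalizing M p with
  | nil => exact h.le_length hxs hm
  | cons r rs ih =>
    rw [isRegular_cons_iff] at hrs
    have := ih (QuotSMulTop r M) (p + 1)
      (h.quotSMulTop hrs.1 (hrm r List.mem_cons_self)) hrs.2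
      fun s hs => hrm s (List.mem_cons_of_mem _ hs)
    rw [List.length_cons]
    omega

theorem HasMinimalResolution.exists_isWeaklyRegular [IsNoetherianRing R] {𝔪 : Ideal R}
    [𝔪.IsMaximal] {xs : List R} (hxs : IsRegular R xs) (hm : Ideal.ofList xs = 𝔪) (t : ℕ)
    (M : Type*) [AddCommGroup M] [Module R M] (p : ℕ) (h : HasMinimalResolution 𝔪 M p)
    (ht : p + t ≤ xs.length) :
    ∃ rs : List R, rs.length = t ∧ (∀ r ∈ rs, r ∈ 𝔪) ∧ IsWeaklyRegular M rs := by
  induction t generalizing M p with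
  | zero => exact ⟨[], rfl, by simp, IsWeaklyRegular.nil _ _⟩
  | succ t ih =>
    obtain ⟨r, hrm, hr⟩ := h.exists_regular hxs hm (by omega)
    obtain ⟨rs, hl, hrs, hreg⟩ := ih (QuotSMulTop r M) (p + 1) (h.quotSMulTop hr hrm) (by omega)
    exact ⟨r :: rs, by simp [hl], by simpa [hrm] using hrs, hreg.cons hr⟩

end Depth

/-! ### The variables as a regular sequence, and the Auslander–Buchsbaum formula. -/

section Polynomial

variable {σ k : Type*} [Field k]

theorem ofList_X (l : List σ) :
    Ideal.ofList (l.map (MvPolynomial.X (R := k))) =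
      monomialIdeal k (l.map fun i => Finsupp.single i 1) := by
  unfold monomialIdeal Ideal.ofList
  congr 1
  ext p
  simp [MvPolynomial.X, eq_comm]

theorem isWeaklyRegular_X {l : List σ} (hl : l.Nodup) :
    IsWeaklyRegular (MvPolynomial σ k) (l.map (MvPolynomial.X (R := k))) where
  regular_mod_prev i hi := by
    classical
    rw [← List.map_take, isSMulRegular_quotient_iff_mem_of_smul_mem]
    intro p hp
    rw [smul_eq_mul, Ideal.mul_top, ofList_X] at hp ⊢
    rw [List.getElem_map, smul_eq_mul, mul_comm, MvPolynomial.X,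
      mul_monomial_mem_monomialIdeal] at hp
    rw [mem_monomialIdeal]
    intro s hs
    obtain ⟨a, ha, has⟩ := hp s hs
    refine ⟨a, ha, ?_⟩
    obtain ⟨j, hj, rfl⟩ := List.mem_map.1 ha
    rw [Finsupp.single_le_iff] at has ⊢
    -- An earlier variable differs from the current one, so if it divides the product of a monomial
    -- with the current variable, it divides the monomial.
    have hne : l[i]'(by simpa using hi) ≠ j := by
      rintro rfl
      obtain ⟨i', hi', he⟩ := List.mem_take_iff_getElem.1 hj
      have := (List.Nodup.getElem_inj_iff hl).1 he
      omega
    simpa [Finsupp.single_apply, hne] using has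

theorem isRegular_X {l : List σ} (hl : l.Nodup) :
    IsRegular (MvPolynomial σ k) (l.map (MvPolynomial.X (R := k))) where
  toIsWeaklyRegular := isWeaklyRegular_X hl
  top_ne_smul := by
    intro h
    have h1 : (1 : MvPolynomial σ k) ∈ (⊤ : Ideal (MvPolynomial σ k)) := trivial
    rw [h, smul_eq_mul, Ideal.mul_top, ofList_X, mem_monomialIdeal] at h1
    obtain ⟨a, ha, ha'⟩ := h1 0 (by simp)
    obtain ⟨j, -, rfl⟩ := List.mem_map.1 ha
    simpa using ha' j

instance idealOfVars_isMaximal : (MvPolynomial.idealOfVars σ k).IsMaximal := by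
  have : MvPolynomial.idealOfVars σ k =
      RingHom.ker (MvPolynomial.constantCoeff (R := k) (σ := σ)) := by
    ext p
    rw [mem_idealOfVars_iff, RingHom.mem_ker]
  rw [this]
  exact RingHom.ker_isMaximal_of_surjective _ fun c => ⟨MvPolynomial.C c, by simp⟩

/-- The Auslander–Buchsbaum formula for cyclic modules over a polynomial ring. -/
theorem depth_eq_of_hasMinimalResolution {n p : ℕ} {I : Ideal (MvPolynomial (Fin n) k)}
    (hI : I ≤ MvPolynomial.idealOfVars (Fin n) k)
    (h : HasMinimalResolution (MvPolynomial.idealOfVars (Fin n) k) (MvPolynomial (Fin n) k ⧸ I) p) :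
    depth (Fin n) k (MvPolynomial (Fin n) k ⧸ I) = ((n - p : ℕ) : ℕ∞) := by
  let xs := (List.finRange n).map (MvPolynomial.X (R := k))
  have hxs : IsRegular (MvPolynomial (Fin n) k) xs := isRegular_X (List.nodup_finRange n)
  have hm : Ideal.ofList xs = MvPolynomial.idealOfVars (Fin n) k := by
    unfold Ideal.ofList MvPolynomial.idealOfVars
    congr 1
    ext p
    simp [xs]
  have hlen : xs.length = n := by simp [xs]
  apply le_antisymm
  · refine iSup₂_le fun rs hrs => ?_
    have := h.add_length_le hxs hm rs _ p hrs.2 hrs.1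
    rw [hlen] at this
    exact_mod_cast (by omega : rs.length ≤ n - p)
  · have hp := h.le_length hxs hm
    obtain ⟨rs, hl, hrs, hreg⟩ := HasMinimalResolution.exists_isWeaklyRegular hxs hm (n - p)
      _ p h (by omega)
    rw [← hl]
    -- Weak regularity becomes regularity because `R/I` maps onto `R/𝔪`, where `rs` acts as zero and
    -- the class of `1` survives.
    refine le_iSup₂_of_le rs ⟨hrs, hreg, fun htop => ?_⟩ le_rfl
    have h1 : Ideal.ofList rs ≤ MvPolynomial.idealOfVars (Fin n) k := Ideal.span_le.2 hrs
    have h2 : (Ideal.Quotient.mk I 1) ∈ Ideal.ofList rs •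
        (⊤ : Submodule (MvPolynomial (Fin n) k) (MvPolynomial (Fin n) k ⧸ I)) := htop ▸ trivial
    have h3 : ∀ y ∈ Ideal.ofList rs •
        (⊤ : Submodule (MvPolynomial (Fin n) k) (MvPolynomial (Fin n) k ⧸ I)),
        Ideal.Quotient.factor hI y = 0 := by
      intro y hy
      refine Submodule.smul_induction_on hy (fun r hr x _ => ?_) (fun x y hx hy => ?_)
      · obtain ⟨q, rfl⟩ := Ideal.Quotient.mk_surjective x
        exact Ideal.Quotient.eq_zero_iff_mem.2 (Ideal.mul_mem_right _ _ (h1 hr))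
      · rw [map_add, hx, hy, add_zero]
    have h4 := h3 _ h2
    rw [Ideal.Quotient.factor_mk, Ideal.Quotient.eq_zero_iff_mem] at h4
    exact (Ideal.ne_top_iff_one _).1 Ideal.IsPrime.ne_top' h4

end Polynomial
end MaxPath
end

/-! ### Rooted trees and the monomials of their maximal paths. -/

noncomputable section
namespace MaxPath

namespace RootedTree

variable {n : ℕ} (T : RootedTree n)

theorem dist_lt_of_child {x y : Fin n} (h : T.Child x y) :
    T.graph.dist T.root x < T.graph.dist T.root y := by
  have := h.2
  omega

theorem not_child_root (x : Fin n) : ¬ T.Child x T.root := fun h => by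
  have := h.2
  rw [SimpleGraph.dist_self] at this
  omega

/-- The parent is the second vertex of a shortest walk from `y` to the root. -/
theorem exists_parent {y : Fin n} (hy : y ≠ T.root) : ∃ x, T.Child x y := by
  obtain ⟨p, hp⟩ := T.isTree.connected.exists_walk_length_eq_dist y T.root
  cases p with
  | nil => exact absurd rfl hy
  | @cons _ x _ hadj q =>
    refine ⟨x, hadj.symm, ?_⟩
    have h1 := SimpleGraph.dist_le q
    rw [SimpleGraph.Walk.length_cons] at hp
    have h2 : T.graph.dist y T.root ≤ T.graph.dist x T.root + 1 := by
      obtain ⟨q', hq'⟩ := T.isTree.connected.exists_walk_length_eq_dist x T.root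
      have := SimpleGraph.dist_le (SimpleGraph.Walk.cons hadj q')
      rwa [SimpleGraph.Walk.length_cons, hq'] at this
    rw [SimpleGraph.dist_comm, SimpleGraph.dist_comm (v := x)]
    omega

theorem exists_isPath_of_child {x y : Fin n} (h : T.Child x y) :
    ∃ p : T.graph.Walk x T.root, (SimpleGraph.Walk.cons h.1.symm p).IsPath := by
  obtain ⟨p, hp⟩ := T.isTree.connected.exists_walk_length_eq_dist x T.root
  refine ⟨p, SimpleGraph.Walk.isPath_of_length_eq_dist _ ?_⟩
  rw [SimpleGraph.Walk.length_cons, hp, SimpleGraph.dist_comm, ← h.2, SimpleGraph.dist_comm]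

/-- A parent followed by a shortest walk to the root extends to a path starting at `y`; in a tree
there is only one such path. -/
theorem parent_unique {x x' y : Fin n} (h : T.Child x y) (h' : T.Child x' y) : x = x' := by
  obtain ⟨p, hp⟩ := T.exists_isPath_of_child h
  obtain ⟨p', hp'⟩ := T.exists_isPath_of_child h'
  have := (T.isTree.isAcyclic.subsingleton_path _ _).elim ⟨_, hp⟩ ⟨_, hp'⟩
  rw [Subtype.mk.injEq, SimpleGraph.Walk.cons.injEq] at this
  exact this.1

/-- Directed walks from the root to `v`. -/
def IsRootChain (l : List (Fin n)) (v : Fin n) : Prop :=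
  l.IsChain T.Child ∧ l.head? = some T.root ∧ l.getLast? = some v

variable {T}

/-- Distance from the root strictly increases along directed edges, so the distinctness required of
directed paths is automatic. -/
theorem IsRootChain.pairwise {l : List (Fin n)} {v : Fin n} (h : T.IsRootChain l v) :
    l.Pairwise fun x y => T.graph.dist T.root x < T.graph.dist T.root y := by
  have : IsTrans (Fin n) fun x y => T.graph.dist T.root x < T.graph.dist T.root y :=
    ⟨fun _ _ _ => lt_trans⟩
  exact List.isChain_iff_pairwise.1 (h.1.imp fun x y => T.dist_lt_of_child)

theorem IsRootChain.nodup {l : List (Fin n)} {v : Fin n} (h : T.IsRootChain l v) : l.Nodup :=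
  h.pairwise.imp fun {x y} hxy (e : x = y) => absurd hxy (by rw [e]; exact lt_irrefl _)

theorem isMaximalPath_iff {l : List (Fin n)} :
    T.IsMaximalPath l ↔ ∃ v, T.IsLeaf v ∧ T.IsRootChain l v :=
  ⟨fun ⟨h1, h2, v, hv, h3⟩ => ⟨v, hv, h1.2, h2, h3⟩,
    fun ⟨v, hv, h⟩ => ⟨⟨h.nodup, h.1⟩, h.2.1, v, hv, h.2.2⟩⟩

theorem IsRootChain.append {l : List (Fin n)} {v w : Fin n} (h : T.IsRootChain l v)
    (hw : T.Child v w) : T.IsRootChain (l ++ [w]) w := by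
  refine ⟨List.isChain_append.2 ⟨h.1, List.isChain_singleton _, ?_⟩, ?_, by simp⟩
  · intro x hx y hy
    rw [h.2.2] at hx
    simp only [Option.mem_def, Option.some.injEq, List.head?_cons] at hx hy
    rw [← hx, ← hy]
    exact hw
  · rw [List.head?_append, h.2.1]
    rfl

theorem exists_isRootChain (v : Fin n) : ∃ l, T.IsRootChain l v := by
  induction hd : T.graph.dist T.root v using Nat.strong_induction_on generalizing v with
  | _ d ih =>
    by_cases hv : v = T.root
    · subst hv
      exact ⟨[T.root], List.isChain_singleton _, rfl, rfl⟩
    · obtain ⟨x, hx⟩ := T.exists_parent hv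
      obtain ⟨l, hl⟩ := ih _ (hd ▸ T.dist_lt_of_child hx) x rfl
      exact ⟨_, hl.append hx⟩

theorem isRootChain_append_singleton {l : List (Fin n)} {v w : Fin n}
    (h : T.IsRootChain (l ++ [w]) v) :
    w = v ∧ (l = [] ∧ v = T.root ∨ ∃ x, T.Child x v ∧ T.IsRootChain l x) := by
  obtain ⟨h1, h2, h3⟩ := h
  obtain rfl : w = v := by simpa using h3
  refine ⟨rfl, ?_⟩
  rcases List.eq_nil_or_concat l with rfl | ⟨l, x, rfl⟩
  · exact Or.inl ⟨rfl, by simpa using h2⟩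
  · refine Or.inr ⟨x, ?_, (List.isChain_append.1 h1).1, ?_, by simp⟩
    · exact (List.isChain_append.1 h1).2.2 x (by simp) w (by simp)
    · rw [List.concat_eq_append, List.head?_append_of_ne_nil _ (by simp)] at h2
      rwa [List.concat_eq_append]

theorem IsRootChain.unique {l l' : List (Fin n)} {v : Fin n} (h : T.IsRootChain l v)
    (h' : T.IsRootChain l' v) : l = l' := by
  induction l using List.reverseRecOn generalizing l' v with
  | nil => simpa using h.2.1
  | append_singleton l w ih =>
    rcases List.eq_nil_or_concat l' with rfl | ⟨l', w', rfl⟩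
    · simpa using h'.2.1
    · rw [List.concat_eq_append] at h' ⊢
      obtain ⟨rfl, h1⟩ := isRootChain_append_singleton h
      obtain ⟨rfl, h2⟩ := isRootChain_append_singleton h'
      rcases h1 with ⟨rfl, h1⟩ | ⟨x, hx, h1⟩ <;> rcases h2 with ⟨rfl, h2⟩ | ⟨x', hx', h2⟩
      · rfl
      · exact absurd (h1 ▸ hx') (T.not_child_root _)
      · exact absurd (h2 ▸ hx) (T.not_child_root _)
      · obtain rfl := T.parent_unique hx hx'
        rw [ih h1 h2]

/-- A vertex followed by another one in the chain has a child. This is the source of the private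
variables. -/
theorem IsRootChain.eq_of_isLeaf_mem {l : List (Fin n)} {v w : Fin n} (h : T.IsRootChain l v)
    (hw : T.IsLeaf w) (hwl : w ∈ l) : w = v := by
  obtain ⟨s, t, rfl⟩ := List.append_of_mem hwl
  cases t with
  | nil => simpa using h.2.2
  | cons b t =>
    have := (List.isChain_append.1 h.1).2.1
    exact absurd (List.isChain_cons_cons.1 this).1 (hw b)

/-- Extend the chain by a child until a leaf is reached; its vertices are distinct, so its length is
at most `n`. -/
theorem IsRootChain.exists_leaf {l : List (Fin n)} {v : Fin n} (h : T.IsRootChain l v) :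
    ∃ w l', T.IsLeaf w ∧ T.IsRootChain l' w ∧ l ⊆ l' := by
  induction hm : n - l.length using Nat.strong_induction_on generalizing l v with
  | _ m ih =>
    by_cases hv : T.IsLeaf v
    · exact ⟨v, l, hv, h, List.Subset.refl _⟩
    · unfold IsLeaf at hv
      push Not at hv
      obtain ⟨y, hy⟩ := hv
      have h' := h.append hy
      have hlen := h'.nodup.length_le_card
      rw [List.length_append, List.length_singleton, Fintype.card_fin] at hlen
      obtain ⟨w, l', hw, hl', hsub⟩ := ih _ (by
        rw [List.length_append, List.length_singleton]; omega) h' rfl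
      exact ⟨w, l', hw, hl', fun x hx => hsub (List.mem_append_left _ hx)⟩

variable (T)

/-- The directed path from the root to a vertex. -/
def pathTo (v : Fin n) : List (Fin n) := (exists_isRootChain (T := T) v).choose

theorem isRootChain_pathTo (v : Fin n) : T.IsRootChain (T.pathTo v) v :=
  (exists_isRootChain (T := T) v).choose_spec

theorem root_mem_pathTo (v : Fin n) : T.root ∈ T.pathTo v :=
  List.mem_of_mem_head? (by rw [(T.isRootChain_pathTo v).2.1]; rfl)

theorem self_mem_pathTo (v : Fin n) : v ∈ T.pathTo v :=
  List.mem_of_mem_getLast? (by rw [(T.isRootChain_pathTo v).2.2]; rfl)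

theorem exists_leaf_mem_pathTo (x : Fin n) : ∃ v, T.IsLeaf v ∧ x ∈ T.pathTo v := by
  obtain ⟨v, l, hv, hl, hsub⟩ := (T.isRootChain_pathTo x).exists_leaf
  rw [hl.unique (T.isRootChain_pathTo v)] at hsub
  exact ⟨v, hv, hsub (T.self_mem_pathTo x)⟩

open Classical in
/-- The exponent vector of the monomial of the path from the root to `v`. -/
def pathExp (v : Fin n) : Fin n →₀ ℕ :=
  Finsupp.equivFunOnFinite.symm fun x => if x ∈ T.pathTo v then 1 else 0

open Classical in
theorem pathExp_apply (v x : Fin n) : T.pathExp v x = if x ∈ T.pathTo v then 1 else 0 := rfl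

theorem prod_X_eq_monomial {k : Type*} [Field k] {l : List (Fin n)} {v : Fin n}
    (h : T.IsRootChain l v) :
    (l.map (MvPolynomial.X (R := k))).prod = MvPolynomial.monomial (T.pathExp v) 1 := by
  classical
  obtain rfl := h.unique (T.isRootChain_pathTo v)
  rw [← List.prod_toFinset _ h.nodup, MvPolynomial.monomial_eq, map_one, one_mul,
    Finsupp.prod_fintype _ _ (fun i => pow_zero _)]
  simp only [pathExp_apply]
  rw [← Finset.prod_subset (Finset.subset_univ (T.pathTo v).toFinset)]
  · exact Finset.prod_congr rfl fun x hx => by rw [if_pos (List.mem_toFinset.1 hx), pow_one]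
  · intro x _ hx
    rw [if_neg fun h => hx (List.mem_toFinset.2 h), pow_zero]

open Classical in
/-- The exponent vectors of the generators of the max-path ideal. -/
def generators : List (Fin n →₀ ℕ) := (Finset.univ.filter T.IsLeaf).toList.map T.pathExp

variable {T} in
theorem mem_generators {a : Fin n →₀ ℕ} :
    a ∈ T.generators ↔ ∃ v, T.IsLeaf v ∧ T.pathExp v = a := by
  simp [generators]

theorem maxPathIdeal_eq (k : Type*) [Field k] :
    T.maxPathIdeal k = monomialIdeal k T.generators := by
  unfold maxPathIdeal monomialIdeal
  congr 1
  ext p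
  constructor
  · rintro ⟨l, hl, rfl⟩
    obtain ⟨v, hv, hl⟩ := isMaximalPath_iff.1 hl
    exact ⟨_, mem_generators.2 ⟨v, hv, rfl⟩, T.prod_X_eq_monomial hl⟩
  · rintro ⟨a, ha, rfl⟩
    obtain ⟨v, hv, rfl⟩ := mem_generators.1 ha
    exact ⟨_, isMaximalPath_iff.2 ⟨v, hv, T.isRootChain_pathTo v⟩,
      (T.prod_X_eq_monomial (T.isRootChain_pathTo v)).symm⟩

theorem pathExp_self (v : Fin n) : T.pathExp v v = 1 := if_pos (T.self_mem_pathTo v)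

theorem pathExp_root (v : Fin n) : T.pathExp v T.root = 1 := if_pos (T.root_mem_pathTo v)

theorem pathExp_apply_leaf {v w : Fin n} (hw : T.IsLeaf w) (hne : w ≠ v) : T.pathExp v w = 0 :=
  if_neg fun h => hne ((T.isRootChain_pathTo v).eq_of_isLeaf_mem hw h)

theorem hasPrivateVars_generators : HasPrivateVars T.generators := by
  classical
  constructor
  · refine List.Nodup.map_on ?_ (Finset.nodup_toList _)
    intro v hv w hw hvw
    by_contra hne
    have hv' : T.IsLeaf v := by simpa using hv
    have := T.pathExp_apply_leaf hv' hne
    rw [← hvw, pathExp_self] at this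
    exact one_ne_zero this
  · intro a ha
    obtain ⟨v, hv, rfl⟩ := mem_generators.1 ha
    refine ⟨v, by rw [pathExp_self]; exact one_ne_zero, fun b hb hne => ?_⟩
    obtain ⟨w, -, rfl⟩ := mem_generators.1 hb
    exact T.pathExp_apply_leaf hv fun h => hne (by rw [h])

theorem length_generators : T.generators.length = T.numLeaves := by
  classical
  rw [generators, List.length_map, Finset.length_toList, numLeaves, Nat.card_eq_fintype_card,
    Fintype.card_subtype]

/-- The generators are squarefree and every vertex lies on a path to a leaf, so the lcm is the
product of all variables. -/
theorem degree_lcmList_generators : (lcmList T.generators).degree = n := by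
  have h : ∀ x, lcmList T.generators x = 1 := by
    intro x
    apply le_antisymm
    · have : ∀ l : List (Fin n →₀ ℕ), (∀ a ∈ l, a x ≤ 1) → lcmList l x ≤ 1 := by
        intro l
        induction l with
        | nil => intro _; exact zero_le_one
        | cons a l ih =>
          intro h
          exact sup_le (h a List.mem_cons_self) (ih fun b hb => h b (List.mem_cons_of_mem _ hb))
      refine this _ fun a ha => ?_
      obtain ⟨v, -, rfl⟩ := mem_generators.1 ha
      rw [pathExp_apply]
      split_ifs <;> simp
    · obtain ⟨v, hv, hx⟩ := T.exists_leaf_mem_pathTo x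
      have := le_lcmList (mem_generators.2 ⟨v, hv, rfl⟩) x
      rwa [pathExp_apply, if_pos hx] at this
  rw [Finsupp.degree_eq_sum]
  simp [h]

theorem numLeaves_le : T.numLeaves ≤ n := by
  have := Nat.card_le_card_of_injective (Subtype.val : {x // T.IsLeaf x} → Fin n)
    Subtype.val_injective
  rwa [Nat.card_fin] at this

theorem numLeaves_pos : 0 < T.numLeaves := by
  obtain ⟨v, hv, -⟩ := T.exists_leaf_mem_pathTo T.root
  have : Nonempty {x // T.IsLeaf x} := ⟨⟨v, hv⟩⟩
  exact Nat.card_pos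

theorem IsRootChain.dist_getElem {T : RootedTree n} {l : List (Fin n)} {v : Fin n}
    (h : T.IsRootChain l v) (i : ℕ) (hi : i < l.length) : T.graph.dist T.root l[i] = i := by
  induction i with
  | zero =>
    have h1 := h.2.1
    rw [List.head?_eq_getElem?, List.getElem?_eq_getElem hi, Option.some.injEq] at h1
    rw [h1, SimpleGraph.dist_self]
  | succ i ih =>
    rw [(List.isChain_iff_getElem.1 h.1 i hi).2, ih (by omega)]

/-- If there is a single leaf, the path to it contains every vertex and enumerates the tree.
Conversely, in an enumerated path only the last vertex has no successor. -/
theorem numLeaves_eq_one_iff : T.numLeaves = 1 ↔ T.IsPath := by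
  classical
  constructor
  · intro h
    rw [numLeaves, Nat.card_eq_one_iff_unique] at h
    obtain ⟨hs, ⟨⟨v, hv⟩⟩⟩ := h
    have hmem : ∀ x, x ∈ T.pathTo v := by
      intro x
      obtain ⟨w, hw, hx⟩ := T.exists_leaf_mem_pathTo x
      have : w = v := congrArg Subtype.val (hs.elim ⟨w, hw⟩ ⟨v, hv⟩)
      rwa [this] at hx
    have hc := T.isRootChain_pathTo v
    have hlen : (T.pathTo v).length = n := by
      rw [← List.toFinset_card_of_nodup hc.nodup,
        show (T.pathTo v).toFinset = Finset.univ from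
          Finset.eq_univ_iff_forall.2 fun x => List.mem_toFinset.2 (hmem x), Finset.card_fin]
    refine ⟨(finCongr hlen.symm).trans (hc.nodup.getEquivOfForallMemList _ hmem), ?_⟩
    intro a b
    have hget : ∀ a : Fin n, ((finCongr hlen.symm).trans
        (hc.nodup.getEquivOfForallMemList _ hmem)) a = (T.pathTo v)[(a : ℕ)]'(by omega) :=
      fun a => rfl
    rw [hget, hget]
    constructor
    · intro h
      have := h.2
      rw [hc.dist_getElem, hc.dist_getElem] at this
      exact this.symm
    · intro h
      have := List.isChain_iff_getElem.1 hc.1 a (by omega)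
      simpa only [h] using this
  · rintro ⟨e, he⟩
    rw [numLeaves, Nat.card_eq_one_iff_unique]
    have hleaf : ∀ a : Fin n, T.IsLeaf (e a) ↔ (a : ℕ) + 1 = n := by
      intro a
      constructor
      · intro h
        by_contra hne
        exact h (e ⟨a + 1, by omega⟩) ((he _ _).2 rfl)
      · intro h y hy
        have := (he a (e.symm y)).1 (by simpa using hy)
        omega
    have hn : 0 < n := T.root.pos
    refine ⟨⟨?_⟩, ⟨⟨e ⟨n - 1, by omega⟩, (hleaf _).2 (by simp; omega)⟩⟩⟩
    rintro ⟨x, hx⟩ ⟨y, hy⟩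
    obtain ⟨a, rfl⟩ := e.surjective x
    obtain ⟨b, rfl⟩ := e.surjective y
    have h1 := (hleaf a).1 hx
    have h2 := (hleaf b).1 hy
    have : a = b := Fin.ext (by omega)
    subst this
    rfl

end RootedTree
end MaxPath
end

/-! ### Minimal generators and Krull dimension. -/

noncomputable section
namespace MaxPath

open GradedFreeComplex

section MinimalGenerators

variable {σ k : Type*} [Field k]

/-- The private variable of `b` prevents `b` from dividing any other member of the list, so no
generator is redundant. -/
theorem mem_minimalGenerators_monomialIdeal {L : List (σ →₀ ℕ)} (hL : HasPrivateVars L)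
    {a : σ →₀ ℕ} : a ∈ minimalGenerators (monomialIdeal k L) ↔ a ∈ L := by
  simp only [minimalGenerators, Set.mem_ofPred_eq, monomial_mem_monomialIdeal]
  constructor
  · rintro ⟨⟨b, hb, hba⟩, hmin⟩
    rwa [le_antisymm (hmin ⟨b, hb, le_rfl⟩ hba) hba]
  · intro ha
    refine ⟨⟨a, ha, le_rfl⟩, ?_⟩
    rintro c ⟨b, hb, hbc⟩ hca
    by_cases hab : a = b
    · rwa [hab]
    · obtain ⟨x, hx, hx'⟩ := hL.2 b hb
      have h1 := (hbc.trans hca) x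
      rw [hx' a ha hab] at h1
      omega

theorem IsGeneratorOrder.perm {L l : List (σ →₀ ℕ)} (hL : HasPrivateVars L)
    (hl : IsGeneratorOrder (monomialIdeal k L) l) : l.Perm L :=
  (List.perm_ext_iff_of_nodup hl.1 hL.1).2 fun a =>
    (hl.2 a).trans (mem_minimalGenerators_monomialIdeal hL)

theorem HasPrivateVars.perm {L l : List (σ →₀ ℕ)} (hL : HasPrivateVars L) (h : l.Perm L) :
    HasPrivateVars l := by
  refine ⟨h.nodup_iff.2 hL.1, fun a ha => ?_⟩
  obtain ⟨x, hx, hx'⟩ := hL.2 a (h.mem_iff.1 ha)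
  exact ⟨x, hx, fun b hb => hx' b (h.mem_iff.1 hb)⟩

theorem monomialIdeal_perm {L l : List (σ →₀ ℕ)} (h : l.Perm L) :
    monomialIdeal k l = monomialIdeal k L := by
  simp only [monomialIdeal, h.mem_iff]

theorem HasPrivateVars.isDecreasingType {l : List (σ →₀ ℕ)} (h : HasPrivateVars l) :
    IsDecreasingType (monomialIdeal k l) l where
  order := ⟨h.1, fun _ => (mem_minimalGenerators_monomialIdeal h).symm⟩
  eq_monomialIdeal := rfl
  decreasing j := by
    obtain ⟨x, hx, hx'⟩ := h.2 (l.get j) (List.get_mem l j)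
    refine ⟨x, Finsupp.mem_support_iff.2 hx, fun r hr => ?_⟩
    rw [hx' (l.get r) (List.get_mem l r) fun he =>
      hr.ne (List.nodup_iff_injective_get.1 h.1 he)]
    omega

end MinimalGenerators

theorem hasMinimalResolution_of_card {σ k : Type*} [Field k] {I : Ideal (MvPolynomial σ k)}
    {C : GradedFreeComplex σ k} {ε : C.ι 0 → MvPolynomial σ k ⧸ I}
    (hC : IsMinimalResolution (quotientGrading I) C ε) {m : ℕ}
    (hcard : ∀ i, Fintype.card (C.ι i) = m.choose i) :
    HasMinimalResolution (MvPolynomial.idealOfVars σ k) (MvPolynomial σ k ⧸ I) m := by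
  refine ⟨C.ι, C.fin, C.d, ε, hC.1.isFreeResolution, hC.2, ?_, fun i hi => ?_⟩
  · rw [← Fintype.card_pos_iff, hcard, Nat.choose_self]
    exact one_pos
  · rw [← Fintype.card_eq_zero_iff, hcard, Nat.choose_eq_zero_of_lt hi]

theorem gradedRank_ne_zero_iff {σ k : Type*} [Field k] {C : GradedFreeComplex σ k} {i : ℕ}
    {j : ℤ} : C.gradedRank i j ≠ 0 ↔ ∃ a, C.deg i a = j := by
  rw [gradedRank, Nat.card_ne_zero, nonempty_subtype]
  exact and_iff_left inferInstance

theorem withBot_le_of_add_one_le {x : WithBot ℕ∞} {n : ℕ}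
    (h : x + 1 ≤ ((n + 1 : ℕ) : WithBot ℕ∞)) : x ≤ n := by
  induction x with
  | bot => exact bot_le
  | coe x =>
    refine WithBot.coe_le_coe.2 ((ENat.add_le_add_iff_right ENat.one_ne_top).1 ?_)
    exact WithBot.coe_le_coe.1 h

/-- A nonzero `f ∈ I` is a nonzerodivisor, which bounds the dimension above by `n - 1`. Setting the
variable `r` to zero kills `I` and maps the quotient onto a polynomial ring in `n - 1` variables,
which bounds it below. -/
theorem ringKrullDim_quotient_eq {k : Type*} [Field k] {n : ℕ} {I : Ideal (MvPolynomial (Fin n) k)}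
    (hI : I ≠ ⊥) (r : Fin n) (hr : I ≤ Ideal.span {MvPolynomial.X r}) :
    ringKrullDim (MvPolynomial (Fin n) k ⧸ I) = ((n - 1 : ℕ) : WithBot ℕ∞) := by
  classical
  have hn : 0 < n := r.pos
  apply le_antisymm
  · obtain ⟨f, hf, hf0⟩ := (Submodule.ne_bot_iff I).1 hI
    have h := ringKrullDim_quotient_succ_le_of_nonZeroDivisor
      (mem_nonZeroDivisors_of_ne_zero hf0)
    have h2 := ringKrullDim_le_of_surjective
      (Ideal.Quotient.factor ((Ideal.span_singleton_le_iff_mem I).2 hf))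
      (Ideal.Quotient.factor_surjective _)
    rw [MvPolynomial.ringKrullDim_of_isNoetherianRing, ringKrullDim_eq_zero_of_field, zero_add,
      Nat.card_fin] at h
    refine h2.trans ?_
    obtain ⟨n, rfl⟩ : ∃ i, n = i + 1 := ⟨n - 1, by omega⟩
    rw [Nat.add_sub_cancel]
    exact withBot_le_of_add_one_le h
  · let φ : MvPolynomial (Fin n) k →ₐ[k] MvPolynomial {i : Fin n // i ≠ r} k :=
      MvPolynomial.aeval fun i => if h : i = r then 0 else MvPolynomial.X ⟨i, h⟩
    have hφ : ∀ a ∈ I, φ a = 0 := by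
      intro a ha
      obtain ⟨c, rfl⟩ := Ideal.mem_span_singleton'.1 (hr ha)
      simp [φ]
    have hsurj : Function.Surjective φ := by
      rw [← AlgHom.range_eq_top, eq_top_iff, ← MvPolynomial.adjoin_range_X, Algebra.adjoin_le_iff]
      rintro _ ⟨⟨i, hi⟩, rfl⟩
      exact ⟨MvPolynomial.X i, by simp [φ, hi]⟩
    have h := ringKrullDim_le_of_surjective (Ideal.Quotient.lift I φ.toRingHom hφ)
      (Ideal.Quotient.lift_surjective_of_surjective _ _ hsurj)
    rw [MvPolynomial.ringKrullDim_of_isNoetherianRing, ringKrullDim_eq_zero_of_field, zero_add,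
      Nat.card_eq_fintype_card, Fintype.card_subtype_compl, Fintype.card_fin,
      Fintype.card_subtype_eq] at h
    exact h

end MaxPath
end

/-! ### The main theorem. -/

open MaxPath MaxPath.GradedFreeComplex

theorem theorem3p4 {k : Type*} [Field k] {n : ℕ} (T : MaxPath.RootedTree n) :
    -- (i) decreasing type, and the minimal free resolution is an iterated mapping cone
    ((∃ l : List (Fin n →₀ ℕ), MaxPath.IsDecreasingType (T.maxPathIdeal k) l) ∧
      ∀ l : List (Fin n →₀ ℕ), MaxPath.IsGeneratorOrder (T.maxPathIdeal k) l →
        MaxPath.IsDecreasingType (T.maxPathIdeal k) l ∧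
        (∃ (C : MaxPath.GradedFreeComplex (Fin n) k)
          (ε : C.ι 0 → MvPolynomial (Fin n) k ⧸ T.maxPathIdeal k),
          MaxPath.IsIteratedMappingCone l (T.maxPathIdeal k) C ε) ∧
        ∀ (C : MaxPath.GradedFreeComplex (Fin n) k)
          (ε : C.ι 0 → MvPolynomial (Fin n) k ⧸ T.maxPathIdeal k),
          MaxPath.IsIteratedMappingCone l (T.maxPathIdeal k) C ε →
          MaxPath.GradedFreeComplex.IsMinimalResolution
            (MaxPath.quotientGrading (T.maxPathIdeal k)) C ε) ∧
    -- (ii) dimension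
    ringKrullDim (MvPolynomial (Fin n) k ⧸ T.maxPathIdeal k) = ((n - 1 : ℕ) : WithBot ℕ∞) ∧
    -- (iii) Betti numbers, projective dimension, depth, regularity
    (∀ i : ℕ, MaxPath.betti (Fin n) (MaxPath.quotientGrading (T.maxPathIdeal k)) i =
      T.numLeaves.choose i) ∧
    MaxPath.HasProjDim (Fin n) (MaxPath.quotientGrading (T.maxPathIdeal k)) T.numLeaves ∧
    MaxPath.depth (Fin n) k (MvPolynomial (Fin n) k ⧸ T.maxPathIdeal k) =
      ((n - T.numLeaves : ℕ) : ℕ∞) ∧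
    MaxPath.HasRegularity (Fin n) (MaxPath.quotientGrading (T.maxPathIdeal k))
      ((n : ℤ) - T.numLeaves) ∧
    -- (iv) Cohen–Macaulayness
    (MaxPath.IsCohenMacaulay (Fin n) k (MvPolynomial (Fin n) k ⧸ T.maxPathIdeal k) ↔
      T.IsPath) := by
  have hP := T.hasPrivateVars_generators
  rw [T.maxPathIdeal_eq k]
  obtain ⟨C, ε, hC, hcard, hdeg, a, ha⟩ :=
    exists_isIteratedMappingCone (k := k) _ T.generators T.length_generators hP
  have hmin := (hC.eq_and_isMinimalResolution hP).2
  have hhom := homogClosed_monomialIdeal (k := k) T.generators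
  rw [T.degree_lcmList_generators] at hdeg ha
  have hroot : ∀ b ∈ T.generators, b T.root = 1 := fun b hb => by
    obtain ⟨v, -, rfl⟩ := RootedTree.mem_generators.1 hb
    exact T.pathExp_root v
  have hm := T.numLeaves_pos
  have hmn := T.numLeaves_le
  have hdim : ringKrullDim (MvPolynomial (Fin n) k ⧸ monomialIdeal k T.generators) =
      ((n - 1 : ℕ) : WithBot ℕ∞) := by
    refine ringKrullDim_quotient_eq (fun hbot => ?_) T.root ?_
    · obtain ⟨b, hb⟩ := List.exists_mem_of_length_pos (l := T.generators)
        (by rwa [T.length_generators])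
      have h1 := monomial_mem_monomialIdeal (k := k).2 ⟨b, hb, le_rfl⟩
      rw [hbot, Ideal.mem_bot, MvPolynomial.monomial_eq_zero] at h1
      exact one_ne_zero h1
    · refine Ideal.span_le.2 ?_
      rintro _ ⟨b, hb, rfl⟩
      rw [SetLike.mem_coe, Ideal.mem_span_singleton, MvPolynomial.X_dvd_monomial]
      exact Or.inr (by rw [hroot b hb]; exact one_ne_zero)
  have hdepth := depth_eq_of_hasMinimalResolution (I := monomialIdeal k T.generators) (by
      refine Ideal.span_le.2 ?_
      rintro _ ⟨b, hb, rfl⟩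
      rw [SetLike.mem_coe, mem_idealOfVars_iff, MvPolynomial.constantCoeff_monomial, if_neg]
      rintro rfl
      simpa using hroot 0 hb)
    (hasMinimalResolution_of_card hmin hcard)
  have hbetti : ∀ i j, gradedBetti (σ := Fin n)
      (quotientGrading (monomialIdeal k T.generators)) i j ≠ 0 ↔ ∃ a, C.deg i a = j :=
    fun i j => by rw [gradedBetti_eq hhom hmin, gradedRank_ne_zero_iff]
  -- The same basis element, of homological degree `T.numLeaves` and degree `n`, attains both the
  -- projective dimension and the regularity.
  refine ⟨⟨⟨_, hP.isDecreasingType⟩, fun l hl => ?_⟩, hdim, fun i => ?_, ⟨⟨n, ?_⟩, ?_⟩, hdepth,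
    ⟨⟨T.numLeaves, n, ?_, rfl⟩, ?_⟩, ?_⟩
  · have hperm := hl.perm hP
    have hl' := hP.perm hperm
    rw [← monomialIdeal_perm hperm]
    obtain ⟨D, δ, hD, -⟩ := exists_isIteratedMappingCone (k := k) _ l rfl hl'
    exact ⟨hl'.isDecreasingType, ⟨D, δ, hD⟩, fun D δ hD => (hD.eq_and_isMinimalResolution hl').2⟩
  · rw [betti_eq hhom hmin, hcard]
  · exact (hbetti _ _).2 ⟨a, ha⟩
  · rintro i ⟨j, hj⟩
    obtain ⟨b, -⟩ := (hbetti _ _).1 hj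
    by_contra hlt
    have h0 := hcard i
    rw [Nat.choose_eq_zero_of_lt (not_le.1 hlt), Fintype.card_eq_zero_iff] at h0
    exact h0.false b
  · exact (hbetti _ _).2 ⟨a, ha⟩
  · rintro s ⟨i, j, hij, rfl⟩
    obtain ⟨b, rfl⟩ := (hbetti _ _).1 hij
    exact hdeg i b
  · rw [IsCohenMacaulay, hdepth, Module.supportDim_quotient_eq_ringKrullDim, hdim,
      ← T.numLeaves_eq_one_iff]
    -- The subtractions are truncated; since `1 ≤ T.numLeaves ≤ n`, equality still means that there
    -- is exactly one leaf.
    have hcast : ((((n - T.numLeaves : ℕ) : ℕ∞) : WithBot ℕ∞) = ((n - 1 : ℕ) : WithBot ℕ∞)) ↔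
        n - T.numLeaves = n - 1 :=
      WithBot.coe_inj.trans Nat.cast_inj
    rw [hcast]
    omega
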